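/- Let $n\ge 2$, let $0=k_1<k_2<\dots<k_n=k$ be integers with $\gcd(k_2,\dots,k_n)=1$, and let $A=\begin{bmatrix}1&1&\cdots&1\\ k_1&k_2&\cdots&k_n\end{bmatrix}$, with columns $a_i$. Let $I_A=\langle \partial^u-\partial^w \mid u,w\in\mathbb N^n,\ Au=Aw\rangle\subseteq\mathbb C[\partial]=\mathbb C[\partial_1,\dots,\partial_n]$. For $\beta\in\mathbb C^2$ let $H_A(\beta)$ be the left ideal of the Weyl algebra generated by $I_A$ and by the Euler operators $\sum_j a_{ij}x_j\partial_j-\beta_i$, $i=1,2$. The rank of $H_A(\beta)$ is the dimension of the space of germs of holomorphic solutions at a nonsingular point, that is, a point $x\in\mathbb C^n$ with $x_1x_n\ne 0$ such that $\sum_i x_iz^{k_i}$ has no repeated root $z\in\mathbb C^*$. Let $\mathcal E_A=\{\beta\in\mathbb C^2\mid \operatorname{rank}H_A(\beta)>k\}$ be the set of rank-jumping parameters; here $k$ is the normalized volume of $A$. Suppose $N=\beta_2$ is a nonnegative integer. Let $P$ be the set of ordered partitions $p$ of $N$ with parts in $\{k_2,\dots,k_n\}$; let $|p|$ be the length of $p$,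 $s_i(p)$ its $i$th partial sum, $m_i(p)$ the number of parts of $p$ equal to $k_i$, and let $\ell$ be the least length of an element of $P$. Put $$\varphi(x)=x_1^{\beta_1}\sum_{p\in P}\Big(\prod_{i=\ell}^{|p|-1}(\beta_1-i)\Big)\Big(\prod_{i=1}^{|p|-1}\frac1{N-s_i(p)}\Big)\prod_{i=2}^n k_i^{m_i(p)}\Big(\frac{x_i}{x_1}\Big)^{m_i(p)};$$ this is the finitely supported solution of $H_A(\beta)$ along the line of all parameters with second coordinate $N$ (the factors $\beta_1-i$, $1\le i<\ell$, common to all coefficients of the specialized Euler–Mellin integral, have been removed). If $N'=k\beta_1-\beta_2$ is a nonnegative integer, let $\varphi'$ be given by the same formula with $N$, $x_1$ and the parts $k_i$ ($2\le i\le n$) replaced by $N'$, $x_n$ and the parts $k-k_i$ ($1\le i\le n-1$). Equip $\mathbb C[\partial]/I_A$, its localizations and its local cohomology with the $\mathbb Z^2$-grading in which $\deg\partial_i=a_i$, and compute $H^\bullet_{\langle\partial\rangle}(\mathbb C[\partial]/I_A)$ as the cohomology of the Ishida complex $$0\to\frac{\mathbb C[\partial]}{I_A}\xrightarrow{\ \delta^0\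 }\Big(\frac{\mathbb C[\partial]}{I_A}\Big)_{\partial_1}\oplus\Big(\frac{\mathbb C[\partial]}{I_A}\Big)_{\partial_n}\xrightarrow{\ \delta^1\ }\Big(\frac{\mathbb C[\partial]}{I_A}\Big)_{\partial_1\partial_n}\to0,\qquad \delta^0(r)=(r,r),\quad \delta^1(a,b)=b-a.$$ Theorem. Let $\beta\in\mathcal E_A$. Then $\beta\in\mathbb Z^2$, $\beta_2$ and $k\beta_1-\beta_2$ are nonnegative integers, and $\varphi$ and $\varphi'$ are nonzero. If $x^v$ and $x^{v'}$ are monomials appearing with nonzero coefficients in $\varphi$ and $\varphi'$ respectively, then $v,v'\in\mathbb Z^n$, $v_i\ge0$ for $i\neq1$, $v'_i\ge0$ for $i\ne n$, and $$(\partial^v,\partial^{v'})\in\Big(\frac{\mathbb C[\partial]}{I_A}\Big)_{\partial_1}\oplus\Big(\frac{\mathbb C[\partial]}{I_A}\Big)_{\partial_n}$$ is a cocycle, $\delta^1(\partial^v,\partial^{v'})=0$, whose class in $H^1_{\langle\partial\rangle}(\mathbb C[\partial]/I_A)$ is nonzero and spans the graded component $[H^1_{\langle\partial\rangle}(\mathbb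 C[\partial]/I_A)]_\beta$ over $\mathbb C$. -/

import Mathlib

open scoped Topology

noncomputable section

namespace MonomialCurve

/-! ### The matrix and its toric ideal -/

/-- The `2 × n` integer matrix whose `j`-th column is `(1, k j)`. -/
def curveMatrix {n : ℕ} (k : Fin n → ℕ) : Matrix (Fin 2) (Fin n) ℤ :=
  Matrix.of ![fun _ => 1, fun j => (k j : ℤ)]

/-- The toric ideal `⟨∂^u - ∂^w ∣ A u = A w⟩ ⊆ ℂ[∂₁, …, ∂ₙ]`. -/
def toricIdeal {d n : ℕ} (A : Matrix (Fin d) (Fin n) ℤ) : Ideal (MvPolynomial (Fin n) ℂ) :=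
  Ideal.span {P | ∃ u w : Fin n →₀ ℕ,
    A.mulVec (fun j => (u j : ℤ)) = A.mulVec (fun j => (w j : ℤ)) ∧
    P = MvPolynomial.monomial u 1 - MvPolynomial.monomial w 1}

/-! ### Solutions of the hypergeometric system, rank, rank-jumping parameters -/

/-- The partial derivative `∂f/∂x_i`. -/
def partialD {n : ℕ} (i : Fin n) (f : (Fin n → ℂ) → ℂ) : (Fin n → ℂ) → ℂ :=
  fun x => fderiv ℂ f x (Pi.single i 1)

/-- The iterated partial derivative `∂₁^{u₁} ⋯ ∂ₙ^{uₙ} f`. -/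
def monomialD {n : ℕ} (u : Fin n →₀ ℕ) (f : (Fin n → ℂ) → ℂ) : (Fin n → ℂ) → ℂ :=
  (List.finRange n).foldr (fun i g => (partialD i)^[u i] g) f

/-- The action on functions of the constant coefficient operator `P(∂)`. -/
def polyD {n : ℕ} (P : MvPolynomial (Fin n) ℂ) (f : (Fin n → ℂ) → ℂ) : (Fin n → ℂ) → ℂ :=
  fun x => ∑ u ∈ P.support, P.coeff u * monomialD u f x

/-- The action on functions of the Euler operator `∑ⱼ a_{ij} xⱼ ∂ⱼ - βᵢ`. -/
def eulerD {d n : ℕ} (A : Matrix (Fin d) (Fin n) ℤ) (β : Fin d → ℂ) (i : Fin d)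
    (f : (Fin n → ℂ) → ℂ) : (Fin n → ℂ) → ℂ :=
  fun x => ∑ j, (A i j : ℂ) * x j * partialD j f x - β i * f x

/-- `f` is holomorphic near `p` and is annihilated near `p` by `I_A` and by the Euler operators,
that is, by the left ideal `H_A(β)` of the Weyl algebra that they generate. -/
structure IsSolutionAt {d n : ℕ} (A : Matrix (Fin d) (Fin n) ℤ) (β : Fin d → ℂ)
    (p : Fin n → ℂ) (f : (Fin n → ℂ) → ℂ) : Prop where
  analyticAt : AnalyticAt ℂ f p
  toric : ∀ P ∈ toricIdeal A, polyD P f =ᶠ[𝓝 p] 0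
  euler : ∀ i, eulerD A β i f =ᶠ[𝓝 p] 0

section Linearity

variable {n : ℕ} {p : Fin n → ℂ} {f g : (Fin n → ℂ) → ℂ}

theorem analyticAt_partialD (hf : AnalyticAt ℂ f p) (i : Fin n) :
    AnalyticAt ℂ (partialD i f) p := by
  have h := ((ContinuousLinearMap.apply ℂ ℂ (Pi.single i (1 : ℂ) : Fin n → ℂ)).analyticAt
    (fderiv ℂ f p)).comp hf.fderiv
  exact h

theorem partialD_congr (h : f =ᶠ[𝓝 p] g) (i : Fin n) : partialD i f =ᶠ[𝓝 p] partialD i g := by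
  filter_upwards [h.fderiv (𝕜 := ℂ)] with x hx
  simp only [partialD, hx]

theorem partialD_comb (hf : AnalyticAt ℂ f p) (hg : AnalyticAt ℂ g p) (c : ℂ) (i : Fin n) :
    partialD i (fun x => f x + c * g x) =ᶠ[𝓝 p] fun x => partialD i f x + c * partialD i g x := by
  filter_upwards [hf.eventually_analyticAt, hg.eventually_analyticAt] with x hfx hgx
  have hg' := hgx.differentiableAt
  simp only [partialD]
  rw [fderiv_fun_add hfx.differentiableAt (hg'.const_mul c), fderiv_const_mul hg' c]
  simp

theorem monomialD_spec (hf : AnalyticAt ℂ f p) (hg : AnalyticAt ℂ g p) (c : ℂ)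
    (u : Fin n →₀ ℕ) (l : List (Fin n)) :
    AnalyticAt ℂ (l.foldr (fun i g => (partialD i)^[u i] g) f) p ∧
    AnalyticAt ℂ (l.foldr (fun i g => (partialD i)^[u i] g) g) p ∧
    l.foldr (fun i g => (partialD i)^[u i] g) (fun x => f x + c * g x) =ᶠ[𝓝 p]
      fun x => l.foldr (fun i g => (partialD i)^[u i] g) f x
        + c * l.foldr (fun i g => (partialD i)^[u i] g) g x := by
  induction l with
  | nil => exact ⟨hf, hg, Filter.EventuallyEq.rfl⟩
  | cons i l ih =>
    simp only [List.foldr_cons]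
    generalize u i = r
    induction r with
    | zero => exact ih
    | succ r ihr =>
      simp only [Function.iterate_succ_apply']
      exact ⟨analyticAt_partialD ihr.1 i, analyticAt_partialD ihr.2.1 i,
        (partialD_congr ihr.2.2 i).trans (partialD_comb ihr.1 ihr.2.1 c i)⟩

theorem polyD_comb (hf : AnalyticAt ℂ f p) (hg : AnalyticAt ℂ g p) (c : ℂ)
    (P : MvPolynomial (Fin n) ℂ) :
    polyD P (fun x => f x + c * g x) =ᶠ[𝓝 p] fun x => polyD P f x + c * polyD P g x := by
  have h : ∀ᶠ x in 𝓝 p, ∀ u ∈ P.support, monomialD u (fun x => f x + c * g x) x =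
      monomialD u f x + c * monomialD u g x :=
    (Finset.eventually_all P.support).2 fun u _ => (monomialD_spec hf hg c u _).2.2
  filter_upwards [h] with x hx
  simp only [polyD]
  rw [Finset.sum_congr rfl fun u hu => by rw [hx u hu], Finset.mul_sum, ← Finset.sum_add_distrib]
  exact Finset.sum_congr rfl fun u _ => by ring

theorem eulerD_comb {d : ℕ} (A : Matrix (Fin d) (Fin n) ℤ) (β : Fin d → ℂ) (i : Fin d)
    (hf : AnalyticAt ℂ f p) (hg : AnalyticAt ℂ g p) (c : ℂ) :
    eulerD A β i (fun x => f x + c * g x) =ᶠ[𝓝 p]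
      fun x => eulerD A β i f x + c * eulerD A β i g x := by
  have h : ∀ᶠ x in 𝓝 p, ∀ j, partialD j (fun x => f x + c * g x) x =
      partialD j f x + c * partialD j g x :=
    Filter.eventually_all.2 fun j => partialD_comb hf hg c j
  filter_upwards [h] with x hx
  simp only [eulerD, hx, mul_add, mul_sub, Finset.sum_add_distrib, Finset.mul_sum]
  have : ∀ j, (A i j : ℂ) * x j * (c * partialD j g x) = c * ((A i j : ℂ) * x j * partialD j g x) :=
    fun j => by ring
  simp only [this]
  ring

theorem IsSolutionAt.comb {d : ℕ} {A : Matrix (Fin d) (Fin n) ℤ} {β : Fin d → ℂ}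
    (hf : IsSolutionAt A β p f) (hg : IsSolutionAt A β p g) (c : ℂ) :
    IsSolutionAt A β p (fun x => f x + c * g x) where
  analyticAt := hf.analyticAt.add (analyticAt_const.mul hg.analyticAt)
  toric P hP := by
    filter_upwards [polyD_comb hf.analyticAt hg.analyticAt c P, hf.toric P hP, hg.toric P hP]
      with x h1 h2 h3
    rw [h1, h2, h3]; simp
  euler i := by
    filter_upwards [eulerD_comb A β i hf.analyticAt hg.analyticAt c, hf.euler i, hg.euler i]
      with x h1 h2 h3
    rw [h1, h2, h3]; simp

theorem isSolutionAt_zero {d : ℕ} (A : Matrix (Fin d) (Fin n) ℤ) (β : Fin d → ℂ) :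
    IsSolutionAt A β p (fun _ => 0) := by
  have h1 : ∀ i : Fin n, partialD i (fun _ => (0 : ℂ)) = fun _ => 0 := fun i => by
    funext x; simp [partialD]
  have h2 : ∀ u : Fin n →₀ ℕ, monomialD u (fun _ => (0 : ℂ)) = fun _ => 0 := fun u => by
    unfold monomialD
    induction List.finRange n with
    | nil => rfl
    | cons i l ih =>
      rw [List.foldr_cons, ih]
      exact Function.iterate_fixed (h1 i) _
  refine ⟨analyticAt_const, fun P _ => ?_, fun i => ?_⟩
  · exact Filter.Eventually.of_forall fun x => by simp [polyD, h2]
  · exact Filter.Eventually.of_forall fun x => by simp [eulerD, h1]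

end Linearity

/-- The complex vector space of germs at `p` of holomorphic solutions of `H_A(β)`. -/
def solutionGerms {d n : ℕ} (A : Matrix (Fin d) (Fin n) ℤ) (β : Fin d → ℂ) (p : Fin n → ℂ) :
    Submodule ℂ ((𝓝 p).Germ ℂ) where
  carrier := {φ | ∃ f : (Fin n → ℂ) → ℂ, IsSolutionAt A β p f ∧ φ = (f : (𝓝 p).Germ ℂ)}
  add_mem' := by
    rintro _ _ ⟨f, hf, rfl⟩ ⟨g, hg, rfl⟩
    refine ⟨_, hf.comb hg 1, ?_⟩
    rw [← Filter.Germ.coe_add]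
    congr 1
    funext x
    simp
  zero_mem' := ⟨_, isSolutionAt_zero A β, rfl⟩
  smul_mem' := by
    rintro c _ ⟨f, hf, rfl⟩
    refine ⟨_, (isSolutionAt_zero A β).comb hf c, ?_⟩
    rw [← Filter.Germ.coe_smul]
    congr 1
    funext x
    simp

variable {m : ℕ}

/-- The polynomial `f(z) = ∑ᵢ xᵢ z^{kᵢ}`. -/
def curvePolynomial (k : Fin (m + 2) → ℕ) (x : Fin (m + 2) → ℂ) : Polynomial ℂ :=
  ∑ i, Polynomial.C (x i) * Polynomial.X ^ k i

/-- The complement of the singular locus: `x₁ xₙ ≠ 0`, and `f` has no repeated root in `ℂ^*`. -/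
def nonsingularLocus (k : Fin (m + 2) → ℕ) : Set (Fin (m + 2) → ℂ) :=
  {x | x 0 ≠ 0 ∧ x (Fin.last (m + 1)) ≠ 0 ∧
    ¬ ∃ z : ℂ, z ≠ 0 ∧ (curvePolynomial k x).IsRoot z ∧
      (Polynomial.derivative (curvePolynomial k x)).IsRoot z}

/-- The set of rank-jumping parameters: those `β` for which the space of germs of solutions of
`H_A(β)` at a nonsingular point has dimension greater than the normalized volume `kₙ` of `A`. -/
def rankJumping (k : Fin (m + 2) → ℕ) : Set (Fin 2 → ℂ) :=
  {β | ∀ p ∈ nonsingularLocus k,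
    (k (Fin.last (m + 1)) : Cardinal) < Module.rank ℂ (solutionGerms (curveMatrix k) β p)}

/-! ### The finitely supported solutions along the polar lines

Both series have the same shape. For the line `β₂ = N` take the base index `b = 1` and
`d i = k i`; for the line `kβ₁ - β₂ = N` take `b = n` and `d i = kₙ - k i`. -/

/-- The ordered partitions of `N` all of whose parts belong to `{d i ∣ i ≠ b}`. -/
def orderedPartitions (d : Fin (m + 2) → ℕ) (b : Fin (m + 2)) (N : ℕ) : Finset (Composition N) :=
  open scoped Classical in
  Finset.univ.filter fun c => ∀ a ∈ c.blocks, ∃ i, i ≠ b ∧ d i = a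

/-- The least length of an ordered partition of `N` with parts in `{d i ∣ i ≠ b}`. -/
def minLength (d : Fin (m + 2) → ℕ) (b : Fin (m + 2)) (N : ℕ) : ℕ :=
  sInf (Composition.length '' (orderedPartitions d b N : Set (Composition N)))

/-- The number `mᵢ(c)` of times that the part `d i` is used in `c`, for `i ≠ b`. -/
def partMultiplicity (d : Fin (m + 2) → ℕ) {N : ℕ} (c : Composition N) (i : Fin (m + 2)) : ℕ :=
  c.blocks.count (d i)

/-- The exponent of `x_b^l ∏_{i ≠ b} (xᵢ / x_b)^{mᵢ(c)}`. -/
def polarExponent (d : Fin (m + 2) → ℕ) (b : Fin (m + 2)) (l : ℂ) {N : ℕ} (c : Composition N) :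
    Fin (m + 2) → ℂ :=
  fun i => if i = b then l - c.length else partMultiplicity d c i

/-- The coefficient belonging to `c`. It is
`∏_{i=1}^{|c|-1} (l - i)/(N - sᵢ(c)) · ∏_{i ≠ b} (d i)^{mᵢ(c)}`, where `sᵢ(c)` is the `i`-th partial
sum, after removal of the factors `l - i`, `1 ≤ i < minLength`, which are those common to all the
coefficients along the line. -/
def polarCoeff (d : Fin (m + 2) → ℕ) (b : Fin (m + 2)) (l : ℂ) {N : ℕ} (c : Composition N) : ℂ :=
  (∏ i ∈ Finset.Ico (minLength d b N) c.length, (l - i)) *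
  (∏ i ∈ Finset.Ico 1 c.length, ((N : ℂ) - c.sizeUpTo i)⁻¹) *
  ∏ i ∈ Finset.univ.erase b, (d i : ℂ) ^ partMultiplicity d c i

/-- The series as a formal finite sum of monomials `x^w`, `w ∈ ℂⁿ`: the map `w ↦` coefficient. -/
def polarSeries (d : Fin (m + 2) → ℕ) (b : Fin (m + 2)) (N : ℕ) (l : ℂ) :
    (Fin (m + 2) → ℂ) →₀ ℂ :=
  ∑ c ∈ orderedPartitions d b N, Finsupp.single (polarExponent d b l c) (polarCoeff d b l c)

/-- The finitely supported solution of `H_A(l, N)` on the line `β₂ = N`. -/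
def polarSolutionFirst (k : Fin (m + 2) → ℕ) (N : ℕ) (l : ℂ) : (Fin (m + 2) → ℂ) →₀ ℂ :=
  polarSeries k 0 N l

/-- The finitely supported solution of `H_A(l, kₙ l - N)` on the line `kₙ β₁ - β₂ = N`. -/
def polarSolutionLast (k : Fin (m + 2) → ℕ) (N : ℕ) (l : ℂ) : (Fin (m + 2) → ℂ) →₀ ℂ :=
  polarSeries (fun i => k (Fin.last (m + 1)) - k i) (Fin.last (m + 1)) N l

/-! ### The Ishida complex and its first cohomology -/

/-- The ring `ℂ[∂]/I_A`. -/
def ToricRing (k : Fin (m + 2) → ℕ) : Type :=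
  MvPolynomial (Fin (m + 2)) ℂ ⧸ toricIdeal (curveMatrix k)

instance (k : Fin (m + 2) → ℕ) : CommRing (ToricRing k) :=
  inferInstanceAs (CommRing (MvPolynomial (Fin (m + 2)) ℂ ⧸ toricIdeal (curveMatrix k)))

instance (k : Fin (m + 2) → ℕ) : Algebra ℂ (ToricRing k) :=
  inferInstanceAs (Algebra ℂ (MvPolynomial (Fin (m + 2)) ℂ ⧸ toricIdeal (curveMatrix k)))

/-- The class of `∂ᵢ` in `ℂ[∂]/I_A`. -/
def del (k : Fin (m + 2) → ℕ) (i : Fin (m + 2)) : ToricRing k :=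
  Ideal.Quotient.mk (toricIdeal (curveMatrix k)) (MvPolynomial.X i)

/-- The localization `(ℂ[∂]/I_A)_{∂_b}`. -/
abbrev AwayDel (k : Fin (m + 2) → ℕ) (b : Fin (m + 2)) : Type :=
  Localization.Away (del k b)

/-- The localization `(ℂ[∂]/I_A)_{∂₁∂ₙ}`. -/
abbrev AwayBoth (k : Fin (m + 2) → ℕ) : Type :=
  Localization.Away (del k 0 * del k (Fin.last (m + 1)))

/-- The localization map `(ℂ[∂]/I_A)_{∂₁} → (ℂ[∂]/I_A)_{∂₁∂ₙ}`. -/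
def awayFirst (k : Fin (m + 2) → ℕ) : AwayDel k 0 →ₐ[ToricRing k] AwayBoth k where
  __ := IsLocalization.Away.awayToAwayRight (S := AwayDel k 0) (P := AwayBoth k)
    (del k 0) (del k (Fin.last (m + 1)))
  commutes' r := IsLocalization.Away.awayToAwayRight_eq (S := AwayDel k 0) (P := AwayBoth k) _ _ r

/-- The localization map `(ℂ[∂]/I_A)_{∂ₙ} → (ℂ[∂]/I_A)_{∂₁∂ₙ}`. -/
def awayLast (k : Fin (m + 2) → ℕ) : AwayDel k (Fin.last (m + 1)) →ₐ[ToricRing k] AwayBoth k where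
  __ := IsLocalization.Away.awayToAwayLeft (S := AwayDel k (Fin.last (m + 1))) (P := AwayBoth k)
    (del k (Fin.last (m + 1))) (del k 0)
  commutes' r := IsLocalization.Away.awayToAwayLeft_eq
    (S := AwayDel k (Fin.last (m + 1))) (P := AwayBoth k) _ _ r

/-- The term of cohomological degree one, `(ℂ[∂]/I_A)_{∂₁} ⊕ (ℂ[∂]/I_A)_{∂ₙ}`. -/
abbrev IshidaOne (k : Fin (m + 2) → ℕ) : Type :=
  AwayDel k 0 × AwayDel k (Fin.last (m + 1))

/-- The differential `δ⁰`, `r ↦ (r, r)`. -/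
def ishidaD0 (k : Fin (m + 2) → ℕ) : ToricRing k →ₗ[ToricRing k] IshidaOne k :=
  (Algebra.linearMap (ToricRing k) (AwayDel k 0)).prod
    (Algebra.linearMap (ToricRing k) (AwayDel k (Fin.last (m + 1))))

/-- The differential `δ¹`, `(a, b) ↦ b - a`. -/
def ishidaD1 (k : Fin (m + 2) → ℕ) : IshidaOne k →ₗ[ToricRing k] AwayBoth k :=
  (awayLast k).toLinearMap ∘ₗ LinearMap.snd _ _ _ - (awayFirst k).toLinearMap ∘ₗ LinearMap.fst _ _ _

theorem ishidaD1_comp_ishidaD0 (k : Fin (m + 2) → ℕ) : ishidaD1 k ∘ₗ ishidaD0 k = 0 := by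
  refine LinearMap.ext fun r => ?_
  change awayLast k (algebraMap _ _ r) - awayFirst k (algebraMap _ _ r) = 0
  rw [AlgHom.commutes, AlgHom.commutes, sub_self]

/-- `H¹_{⟨∂⟩}(ℂ[∂]/I_A) = ker δ¹ / im δ⁰`. -/
abbrev IshidaH1 (k : Fin (m + 2) → ℕ) : Type :=
  LinearMap.ker (ishidaD1 k) ⧸ (LinearMap.range (ishidaD0 k)).submoduleOf (LinearMap.ker (ishidaD1 k))

/-- The cohomology class of a cocycle, as a `ℂ`-linear map. -/
def ishidaClass (k : Fin (m + 2) → ℕ) : LinearMap.ker (ishidaD1 k) →ₗ[ℂ] IshidaH1 k :=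
  (Submodule.mkQ _).restrictScalars ℂ

/-- The Laurent monomial `∂^v` in `(ℂ[∂]/I_A)_{∂_b}`, for `v ∈ ℤⁿ` with `vᵢ ≥ 0` for all `i ≠ b`
(negative entries at `i ≠ b` are read as zero). -/
def laurentMonomial (k : Fin (m + 2) → ℕ) (b : Fin (m + 2)) (v : Fin (m + 2) → ℤ) : AwayDel k b :=
  algebraMap (ToricRing k) (AwayDel k b) (∏ i, del k i ^ (v i).toNat) *
    IsLocalization.Away.invSelf (S := AwayDel k b) (del k b) ^ (-v b).toNat

/-- The component of degree `α ∈ ℤ²` of `(ℂ[∂]/I_A)_{∂_b}`, where `∂ᵢ` has degree the `i`-th column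
of `A`. -/
def awayGraded (k : Fin (m + 2) → ℕ) (b : Fin (m + 2)) (α : Fin 2 → ℤ) : Submodule ℂ (AwayDel k b) :=
  Submodule.span ℂ {y | ∃ v : Fin (m + 2) → ℤ, (∀ i, i ≠ b → 0 ≤ v i) ∧
    (curveMatrix k).mulVec v = α ∧ y = laurentMonomial k b v}

/-- The component of degree `α ∈ ℤ²` of `H¹_{⟨∂⟩}(ℂ[∂]/I_A)`: the classes of the cocycles that are
homogeneous of degree `α`. -/
def ishidaH1Graded (k : Fin (m + 2) → ℕ) (α : Fin 2 → ℤ) : Submodule ℂ (IshidaH1 k) :=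
  (((awayGraded k 0 α).prod (awayGraded k (Fin.last (m + 1)) α)).comap
    ((LinearMap.ker (ishidaD1 k)).subtype.restrictScalars ℂ)).map (ishidaClass k)

end MonomialCurve

end


/-!
Write `K = kₙ` and let `p = (1, 0, …, 0, 1)`. At `p` the toric operators identify the derivatives
`∂^u φ (p)` of a solution germ `φ` that have the same degree `A u`, and the two Euler relations
reduce to linear relations between the derivatives in degrees `A u`, `A u + a₁` and `A u + aₙ`. All
values whose degrees lie in one class modulo `ℤa₁ + ℤaₙ` are therefore determined by a single one,
unless the class meets `ℕA` on both polar lines `β₂ ∈ ℕ` and `Kβ₁ - β₂ ∈ ℕ` in points whose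
intersection `β` is not in `ℕA`. Since the degrees in `ℕA` fill `K / gcd(k₂, …, kₙ)` classes, a larger
rank forces `β ∈ ((ℕA + ℤa₁) ∩ (ℕA + ℤaₙ)) ∖ ℕA`.

At such a gap the terms of `φ` with equal exponents have proportional coefficients with positive
ratios, so nothing cancels, and the exponents of `φ` and `φ'` are integer vectors of degree `β`. In
the localizations of `ℂ[∂]/I_A` every graded component is spanned by any of its Laurent monomials;
mapping to `ℂ[ℤ²]` shows that `(∂^v, ∂^{v'})` does not come from `ℂ[∂]/I_A`, because `β ∉ ℕA`.
-/

noncomputable section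

namespace MonomialCurve

section Derivatives

variable {n d : ℕ} {p : Fin n → ℂ} {f g : (Fin n → ℂ) → ℂ}

theorem partialD_partialD_apply (hf : AnalyticAt ℂ f p) (i j : Fin n) :
    partialD i (partialD j f) p = fderiv ℂ (fderiv ℂ f) p (Pi.single i 1) (Pi.single j 1) := by
  have h := hf.fderiv.differentiableAt.hasFDerivAt.clm_apply
    (hasFDerivAt_const (Pi.single j (1 : ℂ) : Fin n → ℂ) p)
  change fderiv ℂ (fun y => fderiv ℂ f y (Pi.single j 1)) p (Pi.single i 1) = _
  simp [h.fderiv]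

theorem partialD_comm (hf : AnalyticAt ℂ f p) (i j : Fin n) :
    partialD i (partialD j f) =ᶠ[𝓝 p] partialD j (partialD i f) := by
  filter_upwards [hf.eventually_analyticAt] with x hx
  rw [partialD_partialD_apply hx, partialD_partialD_apply hx]
  exact (hx.contDiffAt (n := 2)).isSymmSndFDerivAt (by simp) _ _

theorem analyticAt_iterate_partialD (hf : AnalyticAt ℂ f p) (i : Fin n) (r : ℕ) :
    AnalyticAt ℂ ((partialD i)^[r] f) p := by
  induction r with
  | zero => exact hf
  | succ r ih => rw [Function.iterate_succ_apply']; exact analyticAt_partialD ih i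

theorem iterate_partialD_congr (h : f =ᶠ[𝓝 p] g) (i : Fin n) (r : ℕ) :
    (partialD i)^[r] f =ᶠ[𝓝 p] (partialD i)^[r] g := by
  induction r with
  | zero => exact h
  | succ r ih => simp only [Function.iterate_succ_apply']; exact partialD_congr ih i

theorem partialD_iterate_partialD_comm (hf : AnalyticAt ℂ f p) (i j : Fin n) (r : ℕ) :
    partialD i ((partialD j)^[r] f) =ᶠ[𝓝 p] (partialD j)^[r] (partialD i f) := by
  induction r with
  | zero => rfl
  | succ r ih =>
    simp only [Function.iterate_succ_apply']
    exact (partialD_comm (analyticAt_iterate_partialD hf j r) i j).trans (partialD_congr ih j)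

theorem foldr_partialD_congr (h : f =ᶠ[𝓝 p] g) (u : Fin n →₀ ℕ) (l : List (Fin n)) :
    l.foldr (fun i g => (partialD i)^[u i] g) f =ᶠ[𝓝 p]
      l.foldr (fun i g => (partialD i)^[u i] g) g := by
  induction l with
  | nil => exact h
  | cons i l ih => exact iterate_partialD_congr ih i _

theorem foldr_partialD_add_single_of_notMem (u : Fin n →₀ ℕ) {j : Fin n} {l : List (Fin n)}
    (hj : j ∉ l) :
    l.foldr (fun i g => (partialD i)^[(u + Finsupp.single j 1 : Fin n →₀ ℕ) i] g) f =
      l.foldr (fun i g => (partialD i)^[u i] g) f :=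
  List.foldr_ext _ _ _ fun i hi g => by
    have hij : i ≠ j := fun h => hj (h ▸ hi)
    simp [hij]

theorem foldr_partialD_add_single (hf : AnalyticAt ℂ f p) (u : Fin n →₀ ℕ) {j : Fin n}
    {l : List (Fin n)} (hl : l.Nodup) (hj : j ∈ l) :
    l.foldr (fun i g => (partialD i)^[(u + Finsupp.single j 1 : Fin n →₀ ℕ) i] g) f =ᶠ[𝓝 p]
      partialD j (l.foldr (fun i g => (partialD i)^[u i] g) f) := by
  induction l with
  | nil => simp at hj
  | cons i l ih =>
    obtain ⟨hil, hl⟩ := List.nodup_cons.1 hl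
    simp only [List.foldr_cons]
    rcases eq_or_ne j i with rfl | hji
    · rw [foldr_partialD_add_single_of_notMem u hil]
      simp [Function.iterate_succ_apply']
    · have hui : (u + Finsupp.single j 1 : Fin n →₀ ℕ) i = u i := by simp [hji.symm]
      rw [hui]
      exact (iterate_partialD_congr (ih hl (List.mem_of_ne_of_mem hji hj)) i _).trans
        (partialD_iterate_partialD_comm (monomialD_spec hf hf 0 u l).1 j i _).symm

theorem analyticAt_monomialD (hf : AnalyticAt ℂ f p) (u : Fin n →₀ ℕ) :
    AnalyticAt ℂ (monomialD u f) p :=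
  (monomialD_spec hf hf 0 u _).1

theorem monomialD_congr (h : f =ᶠ[𝓝 p] g) (u : Fin n →₀ ℕ) :
    monomialD u f =ᶠ[𝓝 p] monomialD u g :=
  foldr_partialD_congr h u _

theorem monomialD_zero : monomialD (0 : Fin n →₀ ℕ) f = f := by
  unfold monomialD
  induction List.finRange n with
  | nil => rfl
  | cons i l _ => simp

theorem monomialD_add_single (hf : AnalyticAt ℂ f p) (u : Fin n →₀ ℕ) (j : Fin n) :
    monomialD (u + Finsupp.single j 1) f =ᶠ[𝓝 p] partialD j (monomialD u f) :=
  foldr_partialD_add_single hf u (List.nodup_finRange n) (List.mem_finRange j)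

theorem monomialD_add_const_mul (hf : AnalyticAt ℂ f p) (hg : AnalyticAt ℂ g p) (c : ℂ)
    (u : Fin n →₀ ℕ) :
    monomialD u (fun x => f x + c * g x) p = monomialD u f p + c * monomialD u g p :=
  (monomialD_spec hf hg c u _).2.2.eq_of_nhds

theorem monomialD_fun_zero (u : Fin n →₀ ℕ) : monomialD u (fun _ => 0) p = 0 := by
  have h := monomialD_add_const_mul (p := p) analyticAt_const (analyticAt_const (v := (0 : ℂ)))
    (-1) u (f := fun _ => 0)
  simpa using h

theorem finsupp_induction_add_single {σ : Type*} {motive : (σ →₀ ℕ) → Prop} (u : σ →₀ ℕ)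
    (zero : motive 0) (add_single : ∀ u j, motive u → motive (u + Finsupp.single j 1)) :
    motive u := by
  induction u using Finsupp.induction with
  | zero => exact zero
  | single_add i r u _ _ hu =>
    clear * - hu add_single
    induction r with
    | zero => simpa using hu
    | succ r ih =>
      rw [Finsupp.single_add, add_right_comm]
      exact add_single _ i ih

theorem eulerD_congr (A : Matrix (Fin d) (Fin n) ℤ) (β : Fin d → ℂ) (i : Fin d)
    (h : f =ᶠ[𝓝 p] g) : eulerD A β i f =ᶠ[𝓝 p] eulerD A β i g := by
  filter_upwards [h, Filter.eventually_all.2 fun j => partialD_congr h j] with x hx hDx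
  simp only [eulerD, hx, hDx]

theorem analyticAt_eulerD (A : Matrix (Fin d) (Fin n) ℤ) (β : Fin d → ℂ) (i : Fin d)
    (hf : AnalyticAt ℂ f p) : AnalyticAt ℂ (eulerD A β i f) p := by
  have hx (j : Fin n) : AnalyticAt ℂ (fun x : Fin n → ℂ => x j) p :=
    (ContinuousLinearMap.proj (R := ℂ) j).analyticAt p
  exact (Finset.analyticAt_fun_sum _ fun j _ =>
    (analyticAt_const.mul (hx j)).mul (analyticAt_partialD hf j)).sub (analyticAt_const.mul hf)

theorem hasFDerivAt_eulerD (A : Matrix (Fin d) (Fin n) ℤ) (β : Fin d → ℂ) (i : Fin d)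
    (hf : AnalyticAt ℂ f p) :
    HasFDerivAt (eulerD A β i f)
      (∑ a, ((A i a * p a) • fderiv ℂ (partialD a f) p +
        partialD a f p • (A i a : ℂ) • ContinuousLinearMap.proj (R := ℂ) a) -
          β i • fderiv ℂ f p) p :=
  (HasFDerivAt.fun_sum fun a _ => ((hasFDerivAt_apply a p).const_mul (A i a : ℂ)).mul
    (analyticAt_partialD hf a).differentiableAt.hasFDerivAt).sub
      (hf.differentiableAt.hasFDerivAt.const_mul (β i))

theorem partialD_eulerD (A : Matrix (Fin d) (Fin n) ℤ) (β : Fin d → ℂ) (i : Fin d)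
    (hf : AnalyticAt ℂ f p) (j : Fin n) :
    partialD j (eulerD A β i f) =ᶠ[𝓝 p] eulerD A (β - fun r => (A r j : ℂ)) i (partialD j f) := by
  filter_upwards [Filter.eventually_all.2 fun a => partialD_comm hf a j,
    hf.eventually_analyticAt] with x hcomm hfx
  have hfderiv (a : Fin n) : fderiv ℂ (partialD a f) x (Pi.single j 1) =
      partialD a (partialD j f) x := (hcomm a).symm
  have hpartialD : fderiv ℂ f x (Pi.single j 1) = partialD j f x := rfl
  rw [partialD, (hasFDerivAt_eulerD A β i hfx).fderiv]
  simp only [eulerD, sub_apply, sum_apply, add_apply, smul_apply, ContinuousLinearMap.proj_apply,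
    smul_eq_mul, hfderiv, hpartialD, Finset.sum_add_distrib, Pi.single_apply, mul_ite, mul_one,
    mul_zero, Finset.sum_ite_eq', Finset.mem_univ, if_true, Pi.sub_apply]
  ring

theorem monomialD_eulerD (A : Matrix (Fin d) (Fin n) ℤ) (β : Fin d → ℂ) (i : Fin d)
    (hf : AnalyticAt ℂ f p) (u : Fin n →₀ ℕ) :
    monomialD u (eulerD A β i f) =ᶠ[𝓝 p]
      eulerD A (β - fun r => ∑ j, (A r j : ℂ) * u j) i (monomialD u f) := by
  induction u using finsupp_induction_add_single with
  | zero =>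
    simp only [monomialD_zero, Finsupp.coe_zero, Pi.zero_apply, Nat.cast_zero, mul_zero,
      Finset.sum_const_zero]
    exact Filter.Eventually.of_forall fun x => by simp [eulerD]
  | add_single u j ih =>
    have hshift : (β - fun r => ∑ a, (A r a : ℂ) * u a) - (fun r => (A r j : ℂ)) =
        β - fun r => ∑ a, (A r a : ℂ) * ((u + Finsupp.single j 1 : Fin n →₀ ℕ) a : ℕ) := by
      ext r
      simp [Finsupp.single_apply, mul_add, Finset.sum_add_distrib, sub_sub]
    rw [← hshift]
    exact (monomialD_add_single (analyticAt_eulerD A β i hf) u j).trans <|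
      (partialD_congr ih j).trans <|
      (partialD_eulerD A _ i (analyticAt_monomialD hf u) j).trans <|
      eulerD_congr A _ i (monomialD_add_single hf u j).symm

theorem iteratedFDeriv_succ_apply_single (hf : AnalyticAt ℂ f p) (r : ℕ)
    (w : Fin (r + 1) → Fin n) :
    iteratedFDeriv ℂ (r + 1) f p (fun a => Pi.single (w a) 1) =
      iteratedFDeriv ℂ r (partialD (w (Fin.last r)) f) p
        (fun a => Pi.single (w a.castSucc) 1) := by
  have hcomp := ContinuousLinearMap.iteratedFDeriv_comp_left (i := r) (n := ⊤)
    (ContinuousLinearMap.apply ℂ ℂ (Pi.single (w (Fin.last r)) (1 : ℂ) : Fin n → ℂ))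
    hf.fderiv.contDiffAt (by simp)
  rw [iteratedFDeriv_succ_apply_right]
  exact (congrArg (fun L => L fun a : Fin r => (Pi.single (w a.castSucc) 1 : Fin n → ℂ)) hcomp).symm

theorem iteratedFDeriv_monomialD_eq_zero (hf : AnalyticAt ℂ f p)
    (h : ∀ u, monomialD u f p = 0) (r : ℕ) (u : Fin n →₀ ℕ) :
    iteratedFDeriv ℂ r (monomialD u f) p = 0 := by
  induction r generalizing u with
  | zero => ext; simp [h u]
  | succ r ih =>
    apply ContinuousMultilinearMap.toMultilinearMap_injective
    refine Module.Basis.ext_multilinear (fun _ => Pi.basisFun ℂ (Fin n)) fun w => ?_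
    simp only [ContinuousMultilinearMap.coe_coe, Pi.basisFun_apply]
    rw [iteratedFDeriv_succ_apply_single (analyticAt_monomialD hf u),
      ← ((monomialD_add_single hf u _).iteratedFDeriv (𝕜 := ℂ) r).eq_of_nhds, ih]
    rfl

theorem eventuallyEq_zero_of_monomialD (hf : AnalyticAt ℂ f p) (h : ∀ u, monomialD u f p = 0) :
    f =ᶠ[𝓝 p] 0 := by
  obtain ⟨q, ρ, hq⟩ := hf
  filter_upwards [Metric.eball_mem_nhds p hq.r_pos] with x hx
  have hderiv (r : ℕ) : iteratedFDeriv ℂ r f p = 0 := by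
    simpa only [monomialD_zero] using iteratedFDeriv_monomialD_eq_zero hq.analyticAt h r 0
  have hterm (r : ℕ) : q r (fun _ => x - p) = 0 := by
    simpa [hderiv, Nat.factorial_ne_zero] using hq.factorial_smul (x - p) r
  have hsum := hq.hasSum_sub hx
  simp only [hterm] at hsum
  exact hsum.unique hasSum_zero

end Derivatives

section Solutions

variable {n d : ℕ} {A : Matrix (Fin d) (Fin n) ℤ} {β : Fin d → ℂ} {p : Fin n → ℂ}

/-- The value at `p` of the derivative `∂^u φ` of a germ `φ` of a solution, as a linear form in
`φ`. -/
def solutionDeriv (A : Matrix (Fin d) (Fin n) ℤ) (β : Fin d → ℂ) (p : Fin n → ℂ)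
    (u : Fin n →₀ ℕ) : solutionGerms A β p →ₗ[ℂ] ℂ where
  toFun φ := (φ : (𝓝 p).Germ ℂ).liftOn (fun f => monomialD u f p)
    fun _ _ h => (monomialD_congr h u).eq_of_nhds
  map_add' := by
    rintro ⟨_, f, hf, rfl⟩ ⟨_, g, hg, rfl⟩
    change monomialD u (fun x => f x + g x) p = monomialD u f p + monomialD u g p
    simpa using monomialD_add_const_mul hf.analyticAt hg.analyticAt 1 u
  map_smul' := by
    rintro c ⟨_, f, hf, rfl⟩
    change monomialD u (fun x => c * f x) p = c * monomialD u f p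
    simpa [monomialD_fun_zero] using
      monomialD_add_const_mul (analyticAt_const (v := (0 : ℂ))) hf.analyticAt c u

theorem polyD_monomial_sub_monomial (u w : Fin n →₀ ℕ) (f : (Fin n → ℂ) → ℂ) (x : Fin n → ℂ) :
    polyD (MvPolynomial.monomial u 1 - MvPolynomial.monomial w 1) f x =
      monomialD u f x - monomialD w f x := by
  have hcoeff : AddMonoidAlgebra.coeff (MvPolynomial.monomial u (1 : ℂ) - MvPolynomial.monomial w 1)
      = Finsupp.single u 1 - Finsupp.single w 1 := rfl
  rw [polyD, ← MvPolynomial.sum_def (b := fun v c => c * monomialD v f x), hcoeff,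
    Finsupp.sum_sub_index fun _ _ _ => sub_mul _ _ _, Finsupp.sum_single_index (zero_mul _),
    Finsupp.sum_single_index (zero_mul _), one_mul, one_mul]

theorem solutionDeriv_eq_of_mulVec_eq {u w : Fin n →₀ ℕ}
    (h : A.mulVec (fun j => (u j : ℤ)) = A.mulVec (fun j => (w j : ℤ)))
    (φ : solutionGerms A β p) : solutionDeriv A β p u φ = solutionDeriv A β p w φ := by
  obtain ⟨_, f, hf, rfl⟩ := φ
  have hbinomial := (hf.toric _ (Ideal.subset_span ⟨u, w, h, rfl⟩)).eq_of_nhds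
  rw [polyD_monomial_sub_monomial] at hbinomial
  exact sub_eq_zero.1 hbinomial

theorem sum_mul_solutionDeriv (φ : solutionGerms A β p) (u : Fin n →₀ ℕ) (i : Fin d) :
    ∑ j, (A i j : ℂ) * p j * solutionDeriv A β p (u + Finsupp.single j 1) φ =
      (β i - ∑ j, (A i j : ℂ) * u j) * solutionDeriv A β p u φ := by
  obtain ⟨_, f, hf, rfl⟩ := φ
  have heuler := ((monomialD_eulerD A β i hf.analyticAt u).symm.trans
    (monomialD_congr (hf.euler i) u)).eq_of_nhds
  change ∑ j, (A i j : ℂ) * p j * monomialD (u + Finsupp.single j 1) f p = _ * monomialD u f p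
  simp only [(monomialD_add_single hf.analyticAt u _).eq_of_nhds]
  exact sub_eq_zero.1 (heuler.trans (monomialD_fun_zero u))

theorem eq_zero_of_solutionDeriv {φ : solutionGerms A β p}
    (h : ∀ u, solutionDeriv A β p u φ = 0) : φ = 0 := by
  obtain ⟨_, f, hf, rfl⟩ := φ
  exact Subtype.ext (Filter.Germ.coe_eq.2 (eventuallyEq_zero_of_monomialD hf.analyticAt h))

theorem rank_solutionGerms_le_card {ι : Type*} [Fintype ι] (u : ι → Fin n →₀ ℕ)
    (h : ∀ φ : solutionGerms A β p, (∀ r, solutionDeriv A β p (u r) φ = 0) →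
      ∀ w, solutionDeriv A β p w φ = 0) :
    Module.rank ℂ (solutionGerms A β p) ≤ Fintype.card ι := by
  let values : solutionGerms A β p →ₗ[ℂ] (ι → ℂ) := LinearMap.pi fun r => solutionDeriv A β p (u r)
  have hvalues : Function.Injective values :=
    (injective_iff_map_eq_zero values).2 fun φ hφ =>
      eq_zero_of_solutionDeriv (h φ fun r => congrFun hφ r)
  simpa using LinearMap.lift_rank_le_of_injective values hvalues

end Solutions

section CurveDegrees

variable {m : ℕ} {k : Fin (m + 2) → ℕ} {v : Fin (m + 2) → ℤ} {α : Fin 2 → ℤ}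

/-- The exponents `kₙ - kᵢ` of the curve read from its other end. -/
def coexponents (k : Fin (m + 2) → ℕ) (i : Fin (m + 2)) : ℕ := k (Fin.last (m + 1)) - k i

theorem coexponents_last : coexponents k (Fin.last (m + 1)) = 0 :=
  Nat.sub_self _

theorem coexponents_zero (hk0 : k 0 = 0) : coexponents k 0 = k (Fin.last (m + 1)) := by
  rw [coexponents, hk0, Nat.sub_zero]

theorem coexponents_injective (hk : StrictMono k) : Function.Injective (coexponents k) :=
  fun i j hij => hk.injective
    ((tsub_right_inj (hk.monotone (Fin.le_last i)) (hk.monotone (Fin.le_last j))).1 hij)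

theorem sum_coexponents_mul {R : Type*} [CommRing R] (hk : Monotone k) (v : Fin (m + 2) → R) :
    ∑ i, (coexponents k i : R) * v i =
      k (Fin.last (m + 1)) * ∑ i, v i - ∑ i, (k i : R) * v i := by
  simp only [coexponents, Nat.cast_sub (hk (Fin.le_last _)), sub_mul, Finset.sum_sub_distrib,
    Finset.mul_sum]

theorem mulVec_curveMatrix_eq_iff :
    (curveMatrix k).mulVec v = α ↔ ∑ i, v i = α 0 ∧ ∑ i, (k i : ℤ) * v i = α 1 := by
  simp [funext_iff, Fin.forall_fin_two, curveMatrix, dotProduct]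

theorem natCast_weight {σ R : Type*} [Fintype σ] [CommSemiring R] (d : σ → ℕ) (u : σ →₀ ℕ) :
    ((Finsupp.weight d u : ℕ) : R) = ∑ i, (d i : R) * u i := by
  simp [Finsupp.weight_apply, Finsupp.sum_fintype, mul_comm]

theorem last_pos (hk : StrictMono k) : 0 < k (Fin.last (m + 1)) :=
  (Nat.zero_le _).trans_lt (hk Fin.last_pos)

theorem mulVec_curveMatrix_eq_of_weight_eq (hk : StrictMono k) {u w : Fin (m + 2) →₀ ℕ}
    (hfirst : Finsupp.weight k u = Finsupp.weight k w)
    (hlast : Finsupp.weight (coexponents k) u = Finsupp.weight (coexponents k) w) :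
    (curveMatrix k).mulVec (fun j => (u j : ℤ)) =
      (curveMatrix k).mulVec (fun j => (w j : ℤ)) := by
  have hfirst' := congrArg (Nat.cast (R := ℤ)) hfirst
  have hlast' := congrArg (Nat.cast (R := ℤ)) hlast
  simp only [natCast_weight, sum_coexponents_mul hk.monotone] at hfirst' hlast'
  have hsum : ∑ j, (u j : ℤ) = ∑ j, (w j : ℤ) :=
    mul_left_cancel₀ (Nat.cast_ne_zero.2 (last_pos hk).ne') (by linarith)
  exact mulVec_curveMatrix_eq_iff.2
    (hsum ▸ hfirst' ▸ mulVec_curveMatrix_eq_iff.1 rfl)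

theorem mulVec_curveMatrix_eq_iff_coexponents (hk : StrictMono k) :
    (curveMatrix k).mulVec v = α ↔ ∑ i, v i = α 0 ∧
      ∑ i, (coexponents k i : ℤ) * v i = k (Fin.last (m + 1)) * α 0 - α 1 := by
  rw [mulVec_curveMatrix_eq_iff, sum_coexponents_mul hk.monotone]
  exact and_congr_right fun h => by rw [h, sub_right_inj]

theorem weight_add_weight_coexponents (hk : Monotone k) (u : Fin (m + 2) →₀ ℕ) :
    Finsupp.weight k u + Finsupp.weight (coexponents k) u =
      k (Fin.last (m + 1)) * u.degree := by
  simp only [Finsupp.weight_eq_sum, Finsupp.degree_eq_sum, ← Finset.sum_add_distrib, smul_eq_mul,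
    Finset.mul_sum]
  exact Finset.sum_congr rfl fun i _ => by
    rw [coexponents, ← mul_add, Nat.add_sub_cancel' (hk (Fin.le_last i)), mul_comm]

theorem weight_coexponents_modEq (hk : Monotone k) {u w : Fin (m + 2) →₀ ℕ}
    (h : Finsupp.weight k u ≡ Finsupp.weight k w [MOD k (Fin.last (m + 1))]) :
    Finsupp.weight (coexponents k) u ≡ Finsupp.weight (coexponents k) w
      [MOD k (Fin.last (m + 1))] := by
  refine Nat.ModEq.add_left_cancel h ?_
  simp only [weight_add_weight_coexponents hk]
  simp [Nat.ModEq]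

/-- `α ∈ ((ℕA + ℤa₁) ∩ (ℕA + ℤaₙ)) ∖ ℕA`. -/
structure IsGap (k : Fin (m + 2) → ℕ) (α : Fin 2 → ℤ) : Prop where
  first : ∃ v : Fin (m + 2) → ℤ, (∀ i, i ≠ 0 → 0 ≤ v i) ∧ (curveMatrix k).mulVec v = α
  last : ∃ v : Fin (m + 2) → ℤ, (∀ i, i ≠ Fin.last (m + 1) → 0 ≤ v i) ∧
    (curveMatrix k).mulVec v = α
  not_mem : ∀ u : Fin (m + 2) → ℕ, (curveMatrix k).mulVec (fun i => (u i : ℤ)) ≠ α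

theorem IsGap.exists_eq_natCast (hα : IsGap k α) (hk0 : k 0 = 0) : ∃ N : ℕ, α 1 = N := by
  obtain ⟨v, hv, hvα⟩ := hα.first
  rw [← (mulVec_curveMatrix_eq_iff.1 hvα).2]
  refine Int.eq_ofNat_of_zero_le (Finset.sum_nonneg fun i _ => ?_)
  rcases eq_or_ne i 0 with rfl | hi
  · simp [hk0]
  · exact mul_nonneg (Int.natCast_nonneg _) (hv i hi)

theorem IsGap.exists_sub_eq_natCast (hα : IsGap k α) (hk : StrictMono k) :
    ∃ N : ℕ, k (Fin.last (m + 1)) * α 0 - α 1 = N := by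
  obtain ⟨v, hv, hvα⟩ := hα.last
  rw [← ((mulVec_curveMatrix_eq_iff_coexponents hk).1 hvα).2]
  refine Int.eq_ofNat_of_zero_le (Finset.sum_nonneg fun i _ => ?_)
  rcases eq_or_ne i (Fin.last (m + 1)) with rfl | hi
  · simp [coexponents_last]
  · exact mul_nonneg (Int.natCast_nonneg _) (hv i hi)

theorem exists_isGap_of_weight (hk : StrictMono k) (hk0 : k 0 = 0) {u w : Fin (m + 2) →₀ ℕ}
    (hmod : Finsupp.weight k u ≡ Finsupp.weight k w [MOD k (Fin.last (m + 1))])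
    (hgap : ∀ v : Fin (m + 2) →₀ ℕ, Finsupp.weight k v = Finsupp.weight k u →
      Finsupp.weight (coexponents k) v ≠ Finsupp.weight (coexponents k) w) :
    ∃ α, IsGap k α ∧ α 1 = (Finsupp.weight k u : ℕ) ∧
      k (Fin.last (m + 1)) * α 0 - α 1 = (Finsupp.weight (coexponents k) w : ℕ) := by
  obtain ⟨t, ht⟩ : k (Fin.last (m + 1)) ∣
      Finsupp.weight k u + Finsupp.weight (coexponents k) w := by
    refine (Nat.modEq_zero_iff_dvd.1 ((hmod.add_right _).trans ?_))
    rw [weight_add_weight_coexponents hk.monotone]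
    exact Nat.modEq_zero_iff_dvd.2 (dvd_mul_right _ _)
  have ht' : (k (Fin.last (m + 1)) : ℤ) * t - (Finsupp.weight k u : ℕ) =
      (Finsupp.weight (coexponents k) w : ℕ) := by
    rw [sub_eq_iff_eq_add']
    exact_mod_cast ht.symm
  refine ⟨![t, (Finsupp.weight k u : ℕ)], ⟨?_, ?_, fun v hv => ?_⟩, by simp, by simpa using ht'⟩
  · refine ⟨fun i => u i + (Pi.single 0 (t - ∑ j, (u j : ℤ)) : Fin (m + 2) → ℤ) i,
      fun i hi => by simp [hi], mulVec_curveMatrix_eq_iff.2 ⟨?_, ?_⟩⟩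
    · simp [Finset.sum_add_distrib]
    · simp [mul_add, Finset.sum_add_distrib, natCast_weight, Pi.single_apply, hk0]
  · refine ⟨fun i => w i + (Pi.single (Fin.last (m + 1)) (t - ∑ j, (w j : ℤ)) :
      Fin (m + 2) → ℤ) i, fun i hi => by simp [hi],
      (mulVec_curveMatrix_eq_iff_coexponents hk).2 ⟨?_, ?_⟩⟩
    · simp [Finset.sum_add_distrib]
    · simp [mul_add, Finset.sum_add_distrib, Pi.single_apply, coexponents_last, ht',
        ← natCast_weight]
  · have hcoweight := ((mulVec_curveMatrix_eq_iff_coexponents hk).1 hv).2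
    have hweight := (mulVec_curveMatrix_eq_iff.1 hv).2
    refine hgap (Finsupp.equivFunOnFinite.symm v) ?_ ?_ <;> zify
    · simpa [natCast_weight] using hweight
    · simpa [natCast_weight] using hcoweight.trans ht'

end CurveDegrees

section Rays

variable {M R : Type*} [AddMonoid M] [MulZeroClass R] [NoZeroDivisors R] {c g : M → R} {a : R}
  {e u : M}

theorem apply_add_nsmul_eq_zero (hc : ∀ u, a * c (u + e) = g u * c u) (ha : a ≠ 0)
    (hu : c u = 0) (r : ℕ) : c (u + r • e) = 0 := by
  induction r with
  | zero => simpa using hu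
  | succ r ih =>
    have hstep := hc (u + r • e)
    rw [ih, mul_zero, add_assoc, ← succ_nsmul] at hstep
    exact (mul_eq_zero.1 hstep).resolve_left ha

theorem apply_eq_zero_of_add_nsmul (hc : ∀ u, a * c (u + e) = g u * c u) {r : ℕ}
    (hg : ∀ j < r, g (u + j • e) ≠ 0) (hu : c (u + r • e) = 0) : c u = 0 := by
  induction r with
  | zero => simpa using hu
  | succ r ih =>
    refine ih (fun j hj => hg j (hj.trans r.lt_succ_self)) ?_
    have hstep := hc (u + r • e)
    rw [add_assoc, ← succ_nsmul, hu, mul_zero] at hstep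
    exact (mul_eq_zero.1 hstep.symm).resolve_left (hg r r.lt_succ_self)

end Rays

section RankBound

variable {m : ℕ} {k : Fin (m + 2) → ℕ} {β : Fin 2 → ℂ}

/-- The nonsingular point `(1, 0, …, 0, 1)`, where the Euler relations between the derivatives of a
solution only involve `∂₁` and `∂ₙ`. -/
def basePoint (m : ℕ) : Fin (m + 2) → ℂ := Pi.single 0 1 + Pi.single (Fin.last (m + 1)) 1

theorem basePoint_mem_nonsingularLocus (hk : StrictMono k) (hk0 : k 0 = 0) :
    basePoint m ∈ nonsingularLocus k := by
  refine ⟨by simp [basePoint], by simp [basePoint], ?_⟩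
  rintro ⟨z, hz, -, hderiv⟩
  have hpoly : curvePolynomial k (basePoint m) = 1 + Polynomial.X ^ k (Fin.last (m + 1)) := by
    simp [curvePolynomial, basePoint, add_mul, Finset.sum_add_distrib, Pi.single_apply,
      apply_ite Polynomial.C, hk0]
  rw [hpoly] at hderiv
  simp [Polynomial.IsRoot, Polynomial.derivative_X_pow, hz, (last_pos hk).ne'] at hderiv

theorem mul_solutionDeriv_add_last (hk0 : k 0 = 0)
    (φ : solutionGerms (curveMatrix k) β (basePoint m)) (u : Fin (m + 2) →₀ ℕ) :
    (k (Fin.last (m + 1)) : ℂ) *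
        solutionDeriv _ _ _ (u + Finsupp.single (Fin.last (m + 1)) 1) φ =
      (β 1 - (Finsupp.weight k u : ℕ)) * solutionDeriv _ _ _ u φ := by
  have heuler := sum_mul_solutionDeriv φ u 1
  simpa [curveMatrix, basePoint, mul_add, add_mul, Finset.sum_add_distrib, Pi.single_apply, hk0,
    natCast_weight] using heuler

theorem mul_solutionDeriv_add_zero (hk : Monotone k) (hk0 : k 0 = 0)
    (φ : solutionGerms (curveMatrix k) β (basePoint m)) (u : Fin (m + 2) →₀ ℕ) :
    (k (Fin.last (m + 1)) : ℂ) * solutionDeriv _ _ _ (u + Finsupp.single 0 1) φ =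
      (k (Fin.last (m + 1)) * β 0 - β 1 - (Finsupp.weight (coexponents k) u : ℕ)) *
        solutionDeriv _ _ _ u φ := by
  have hsum : solutionDeriv _ _ _ (u + Finsupp.single 0 1) φ +
      solutionDeriv _ _ _ (u + Finsupp.single (Fin.last (m + 1)) 1) φ =
        (β 0 - ∑ j, (u j : ℂ)) * solutionDeriv _ _ _ u φ := by
    simpa [curveMatrix, basePoint, add_mul, Finset.sum_add_distrib, Pi.single_apply] using
      sum_mul_solutionDeriv φ u 0
  have hlast := mul_solutionDeriv_add_last hk0 φ u
  simp only [natCast_weight, sum_coexponents_mul hk] at hlast ⊢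
  linear_combination (k (Fin.last (m + 1)) : ℂ) * hsum - hlast

/-- The degree of `∂^{u₀}` lies on each of the polar lines `β₂ = N` and `kₙβ₁ - β₂ = N'` that is
met by a degree congruent to it modulo `ℤa₁ + ℤaₙ`. -/
structure IsAnchor (k : Fin (m + 2) → ℕ) (β : Fin 2 → ℂ) (u₀ : Fin (m + 2) →₀ ℕ) : Prop where
  first : ∀ w : Fin (m + 2) →₀ ℕ,
    Finsupp.weight k w ≡ Finsupp.weight k u₀ [MOD k (Fin.last (m + 1))] →
    β 1 = (Finsupp.weight k w : ℕ) → Finsupp.weight k w = Finsupp.weight k u₀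
  last : ∀ w : Fin (m + 2) →₀ ℕ,
    Finsupp.weight k w ≡ Finsupp.weight k u₀ [MOD k (Fin.last (m + 1))] →
    k (Fin.last (m + 1)) * β 0 - β 1 = (Finsupp.weight (coexponents k) w : ℕ) →
      Finsupp.weight (coexponents k) w = Finsupp.weight (coexponents k) u₀

theorem exists_add_mul_eq_add_mul_of_modEq {s t K : ℕ} (h : s ≡ t [MOD K]) :
    ∃ r r', s + r * K = t + r' * K ∧ (r = 0 ∨ r' = 0) := by
  rcases le_total s t with hst | hst
  · obtain ⟨r, hr⟩ := (Nat.modEq_iff_dvd' hst).1 h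
    exact ⟨r, 0, by grind, Or.inr rfl⟩
  · obtain ⟨r, hr⟩ := (Nat.modEq_iff_dvd' hst).1 h.symm
    exact ⟨0, r, by grind, Or.inl rfl⟩

theorem weight_add_nsmul_single {σ : Type*} (d : σ → ℕ) (u : σ →₀ ℕ) (i : σ) (r : ℕ) :
    Finsupp.weight d (u + r • Finsupp.single i 1) = Finsupp.weight d u + r * d i := by
  simp [Finsupp.weight_single]

theorem solutionDeriv_eq_zero_of_isAnchor (hk : StrictMono k) (hk0 : k 0 = 0)
    {u₀ u : Fin (m + 2) →₀ ℕ} (h₀ : IsAnchor k β u₀)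
    (hu : Finsupp.weight k u ≡ Finsupp.weight k u₀ [MOD k (Fin.last (m + 1))])
    {φ : solutionGerms (curveMatrix k) β (basePoint m)} (hφ : solutionDeriv _ _ _ u₀ φ = 0) :
    solutionDeriv _ _ _ u φ = 0 := by
  have hK : (k (Fin.last (m + 1)) : ℂ) ≠ 0 := Nat.cast_ne_zero.2 (last_pos hk).ne'
  let value := fun w => solutionDeriv (curveMatrix k) β (basePoint m) w φ
  have hrec_zero := mul_solutionDeriv_add_zero hk.monotone hk0 φ
  have hrec_last := mul_solutionDeriv_add_last hk0 φ
  obtain ⟨r, r', hr, hrr⟩ := exists_add_mul_eq_add_mul_of_modEq hu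
  obtain ⟨q, q', hq, hqq⟩ :=
    exists_add_mul_eq_add_mul_of_modEq (weight_coexponents_modEq hk.monotone hu)
  refine apply_eq_zero_of_add_nsmul (c := value) (r := q) hrec_zero (fun j hj hpole => ?_) <|
    apply_eq_zero_of_add_nsmul (c := value) (r := r) hrec_last (fun j hj hpole => ?_) ?_
  · have hweight := h₀.last (u + j • Finsupp.single 0 1)
      (by rw [weight_add_nsmul_single, hk0]; exact hu) (sub_eq_zero.1 hpole)
    rw [weight_add_nsmul_single, coexponents_zero hk0] at hweight
    have := Nat.mul_lt_mul_of_pos_right hj (last_pos hk)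
    rcases hqq with rfl | rfl <;> grind
  · have hweight := h₀.first (u + q • Finsupp.single 0 1 + j • Finsupp.single (Fin.last (m + 1)) 1)
      (by simpa only [weight_add_nsmul_single, hk0, mul_zero, add_zero, Nat.ModEq,
        Nat.add_mul_mod_self_right] using hu) (sub_eq_zero.1 hpole)
    simp only [weight_add_nsmul_single, hk0] at hweight
    have := Nat.mul_lt_mul_of_pos_right hj (last_pos hk)
    rcases hrr with rfl | rfl <;> grind
  · refine (solutionDeriv_eq_of_mulVec_eq (mulVec_curveMatrix_eq_of_weight_eq hk ?_ ?_) φ).trans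
      (apply_add_nsmul_eq_zero (c := value) hrec_last hK
        (apply_add_nsmul_eq_zero (c := value) hrec_zero hK hφ q') r')
    · simpa only [weight_add_nsmul_single, hk0, mul_zero, add_zero] using hr
    · simpa only [weight_add_nsmul_single, coexponents_zero hk0, coexponents_last, mul_zero,
        add_zero] using hq

theorem exists_residue (hk : StrictMono k) :
    ∃ ρ : (Fin (m + 2) →₀ ℕ) → Fin (k (Fin.last (m + 1)) / Finset.univ.gcd k), ∀ u w, ρ u = ρ w →
      Finsupp.weight k u ≡ Finsupp.weight k w [MOD k (Fin.last (m + 1))] := by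
  set g := Finset.univ.gcd k
  have hdvd (i : Fin (m + 2)) : g ∣ k i := Finset.gcd_dvd (Finset.mem_univ i)
  have hweight (u : Fin (m + 2) →₀ ℕ) : g * (Finsupp.weight k u / g) = Finsupp.weight k u :=
    Nat.mul_div_cancel' <| by
      rw [Finsupp.weight_eq_sum]
      exact Finset.dvd_sum fun i _ => (hdvd i).mul_left _
  have hpos : 0 < k (Fin.last (m + 1)) / g :=
    Nat.div_pos_iff.2 ⟨Nat.pos_of_dvd_of_pos (hdvd _) (last_pos hk),
      Nat.le_of_dvd (last_pos hk) (hdvd _)⟩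
  refine ⟨fun u => ⟨_, Nat.mod_lt (Finsupp.weight k u / g) hpos⟩, fun u w huw => ?_⟩
  have hmod : Finsupp.weight k u / g ≡ Finsupp.weight k w / g [MOD k (Fin.last (m + 1)) / g] :=
    congrArg Fin.val huw
  simpa only [hweight, Nat.mul_div_cancel' (hdvd _)] using hmod.mul_left' g

theorem rank_solutionGerms_le_of_isAnchor (hk : StrictMono k) (hk0 : k 0 = 0)
    (hanchor : ∀ u : Fin (m + 2) →₀ ℕ, ∃ u₀, IsAnchor k β u₀ ∧
      Finsupp.weight k u ≡ Finsupp.weight k u₀ [MOD k (Fin.last (m + 1))]) :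
    Module.rank ℂ (solutionGerms (curveMatrix k) β (basePoint m)) ≤
      (k (Fin.last (m + 1)) / Finset.univ.gcd k : ℕ) := by
  obtain ⟨ρ, hρ⟩ := exists_residue hk
  choose anchor isAnchor_anchor modEq_anchor using hanchor
  refine (rank_solutionGerms_le_card (fun r => anchor (Function.invFun ρ r)) fun φ hφ u => ?_).trans
    (by simp)
  have hu : ρ u = ρ (Function.invFun ρ (ρ u)) := (Function.invFun_eq ⟨u, rfl⟩).symm
  exact solutionDeriv_eq_zero_of_isAnchor hk hk0 (isAnchor_anchor _)
    ((hρ _ _ hu).trans (modEq_anchor _)) (hφ (ρ u))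

theorem exists_isGap_eq_of_weight (hk : StrictMono k) (hk0 : k 0 = 0) {u w : Fin (m + 2) →₀ ℕ}
    (hmod : Finsupp.weight k u ≡ Finsupp.weight k w [MOD k (Fin.last (m + 1))])
    (hu : β 1 = (Finsupp.weight k u : ℕ))
    (hw : k (Fin.last (m + 1)) * β 0 - β 1 = (Finsupp.weight (coexponents k) w : ℕ))
    (hgap : ∀ v : Fin (m + 2) →₀ ℕ, Finsupp.weight k v = Finsupp.weight k u →
      Finsupp.weight (coexponents k) v ≠ Finsupp.weight (coexponents k) w) :
    ∃ α, IsGap k α ∧ ∀ i, β i = α i := by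
  obtain ⟨α, hα, hα₁, hα₀⟩ := exists_isGap_of_weight hk hk0 hmod hgap
  have hβ₁ : β 1 = α 1 := by rw [hu, hα₁, Int.cast_natCast]
  have hβ₀ := congrArg (Int.cast (R := ℂ)) hα₀
  push_cast at hβ₀
  rw [← hw, ← hβ₁, sub_left_inj] at hβ₀
  exact ⟨α, hα, Fin.forall_fin_two.2
    ⟨mul_left_cancel₀ (Nat.cast_ne_zero.2 (last_pos hk).ne') hβ₀.symm, hβ₁⟩⟩

theorem exists_isAnchor (hk : StrictMono k) (hk0 : k 0 = 0)
    (hgap : ∀ α, IsGap k α → ∃ i, β i ≠ α i) (u : Fin (m + 2) →₀ ℕ) :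
    ∃ u₀, IsAnchor k β u₀ ∧
      Finsupp.weight k u ≡ Finsupp.weight k u₀ [MOD k (Fin.last (m + 1))] := by
  by_cases hfirst : ∃ w : Fin (m + 2) →₀ ℕ,
      Finsupp.weight k u ≡ Finsupp.weight k w [MOD k (Fin.last (m + 1))] ∧
        β 1 = (Finsupp.weight k w : ℕ)
  all_goals
    by_cases hlast : ∃ w : Fin (m + 2) →₀ ℕ,
      Finsupp.weight k u ≡ Finsupp.weight k w [MOD k (Fin.last (m + 1))] ∧
        k (Fin.last (m + 1)) * β 0 - β 1 = (Finsupp.weight (coexponents k) w : ℕ)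
  · obtain ⟨w, huw, hw⟩ := hfirst
    obtain ⟨w', huw', hw'⟩ := hlast
    obtain ⟨v, hv, hv'⟩ : ∃ v : Fin (m + 2) →₀ ℕ, Finsupp.weight k v = Finsupp.weight k w ∧
        Finsupp.weight (coexponents k) v = Finsupp.weight (coexponents k) w' := by
      by_contra! hnone
      obtain ⟨α, hα, hβα⟩ :=
        exists_isGap_eq_of_weight hk hk0 (huw.symm.trans huw') hw hw' hnone
      exact (hgap α hα).elim fun i hi => hi (hβα i)
    exact ⟨v, ⟨fun t _ ht => by rw [hv]; exact_mod_cast ht.symm.trans hw,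
      fun t _ ht => by rw [hv']; exact_mod_cast ht.symm.trans hw'⟩, hv ▸ huw⟩
  · obtain ⟨w, huw, hw⟩ := hfirst
    exact ⟨w, ⟨fun t _ ht => by exact_mod_cast ht.symm.trans hw,
      fun t htw ht => (hlast ⟨t, huw.trans htw.symm, ht⟩).elim⟩, huw⟩
  · obtain ⟨w, huw, hw⟩ := hlast
    exact ⟨w, ⟨fun t htw ht => (hfirst ⟨t, huw.trans htw.symm, ht⟩).elim,
      fun t _ ht => by exact_mod_cast ht.symm.trans hw⟩, huw⟩
  · exact ⟨u, ⟨fun t htu ht => (hfirst ⟨t, htu.symm, ht⟩).elim,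
      fun t htu ht => (hlast ⟨t, htu.symm, ht⟩).elim⟩, rfl⟩

theorem exists_isGap_of_lt_rank (hk : StrictMono k) (hk0 : k 0 = 0)
    (hrank : ((k (Fin.last (m + 1)) / Finset.univ.gcd k : ℕ) : Cardinal) <
      Module.rank ℂ (solutionGerms (curveMatrix k) β (basePoint m))) :
    ∃ α, IsGap k α ∧ ∀ i, β i = α i := by
  by_contra! hgap
  exact hrank.not_ge (rank_solutionGerms_le_of_isAnchor hk hk0
    (exists_isAnchor hk hk0 hgap))

end RankBound

section Cohomology

variable {m : ℕ} {k : Fin (m + 2) → ℕ} {b b' : Fin (m + 2)} {v v' : Fin (m + 2) → ℤ}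
  {α : Fin 2 → ℤ}

/-- The class of the monomial `∂^u` in `ℂ[∂]/I_A`. -/
def delMonomial (k : Fin (m + 2) → ℕ) (u : Fin (m + 2) → ℕ) : ToricRing k :=
  ∏ i, del k i ^ u i

theorem delMonomial_add (u w : Fin (m + 2) → ℕ) :
    delMonomial k (u + w) = delMonomial k u * delMonomial k w := by
  simp only [delMonomial, Pi.add_apply, pow_add, Finset.prod_mul_distrib]

theorem delMonomial_single (b : Fin (m + 2)) (r : ℕ) :
    delMonomial k (Pi.single b r) = del k b ^ r := by
  rw [delMonomial, Fintype.prod_eq_single b fun i hi => by simp [hi], Pi.single_eq_same]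

theorem mk_monomial (u : Fin (m + 2) →₀ ℕ) :
    (Ideal.Quotient.mk (toricIdeal (curveMatrix k)) (MvPolynomial.monomial u 1) : ToricRing k) =
      delMonomial k u := by
  rw [MvPolynomial.monomial_eq, map_one, one_mul, Finsupp.prod_fintype _ _ (by simp), map_prod]
  simp only [map_pow]
  rfl

theorem delMonomial_eq_of_mulVec_eq {u w : Fin (m + 2) → ℕ}
    (h : (curveMatrix k).mulVec (fun j => (u j : ℤ)) = (curveMatrix k).mulVec fun j => (w j : ℤ)) :
    delMonomial k u = delMonomial k w := by
  have hmem : MvPolynomial.monomial (Finsupp.equivFunOnFinite.symm u) 1 -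
      MvPolynomial.monomial (Finsupp.equivFunOnFinite.symm w) 1 ∈ toricIdeal (curveMatrix k) :=
    Ideal.subset_span ⟨_, _, h, rfl⟩
  exact (mk_monomial _).symm.trans ((Ideal.Quotient.eq.2 hmem).trans (mk_monomial _))

theorem span_range_delMonomial : Submodule.span ℂ (Set.range (delMonomial k)) = ⊤ := by
  refine Submodule.eq_top_iff'.2 fun r => ?_
  obtain ⟨P, rfl⟩ := Ideal.Quotient.mk_surjective r
  have hP : P ∈ Submodule.span ℂ (Set.range (MvPolynomial.basisMonomials (Fin (m + 2)) ℂ)) :=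
    (MvPolynomial.basisMonomials _ ℂ).mem_span P
  refine Submodule.span_mono ?_ (Submodule.apply_mem_span_image_of_mem_span
    (Ideal.Quotient.mkₐ ℂ (toricIdeal (curveMatrix k))).toLinearMap hP)
  rintro _ ⟨_, ⟨u, rfl⟩, rfl⟩
  exact ⟨u, (mk_monomial u).symm⟩

theorem aeval_single_monomial {σ R G : Type*} [Fintype σ] [CommSemiring R] [AddCommMonoid G]
    (a : σ → G) (u : σ →₀ ℕ) :
    MvPolynomial.aeval (fun i => AddMonoidAlgebra.single (a i) (1 : R))
      (MvPolynomial.monomial u (1 : R)) = AddMonoidAlgebra.single (∑ i, u i • a i) 1 := by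
  have hof (g : G) : AddMonoidAlgebra.single g (1 : R) =
    AddMonoidAlgebra.of R G (Multiplicative.ofAdd g) := rfl
  rw [MvPolynomial.aeval_monomial, map_one, one_mul, Finsupp.prod_fintype _ _ (by simp)]
  simp only [hof, ← map_pow, ← map_prod, ofAdd_sum, ofAdd_nsmul]

theorem sum_nsmul_col_curveMatrix (u : Fin (m + 2) → ℕ) :
    ∑ i, u i • (curveMatrix k).col i = (curveMatrix k).mulVec fun j => (u j : ℤ) := by
  ext r
  simp [Matrix.mulVec, dotProduct, mul_comm]

/-- The homomorphism `ℂ[∂]/I_A → ℂ[ℤ²]` that sends `∂ᵢ` to the monomial whose exponent is the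
`i`-th column of `A`. -/
def toLaurent (k : Fin (m + 2) → ℕ) : ToricRing k →ₐ[ℂ] AddMonoidAlgebra ℂ (Fin 2 → ℤ) :=
  Ideal.Quotient.liftₐ (toricIdeal (curveMatrix k))
    (MvPolynomial.aeval fun i => AddMonoidAlgebra.single ((curveMatrix k).col i) (1 : ℂ))
    fun P hP => by
      refine Submodule.span_induction (p := fun P _ => MvPolynomial.aeval _ P = _) ?_ (map_zero _)
        (fun P Q _ _ hP hQ => by rw [map_add, hP, hQ, add_zero])
        (fun P Q _ hQ => by rw [smul_eq_mul, map_mul, hQ, mul_zero]) hP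
      rintro _ ⟨u, w, h, rfl⟩
      rw [map_sub, aeval_single_monomial, aeval_single_monomial, sum_nsmul_col_curveMatrix,
        sum_nsmul_col_curveMatrix, h, sub_self]

theorem toLaurent_delMonomial (u : Fin (m + 2) → ℕ) :
    toLaurent k (delMonomial k u) =
      AddMonoidAlgebra.single ((curveMatrix k).mulVec fun j => (u j : ℤ)) 1 := by
  rw [← sum_nsmul_col_curveMatrix]
  exact (congrArg (toLaurent k) (mk_monomial (Finsupp.equivFunOnFinite.symm u))).symm.trans
    (aeval_single_monomial _ _)

theorem coeff_toLaurent_eq_zero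
    (hα : ∀ u : Fin (m + 2) → ℕ, (curveMatrix k).mulVec (fun j => (u j : ℤ)) ≠ α)
    (r : ToricRing k) : (toLaurent k r).coeff α = 0 := by
  have hr : r ∈ Submodule.span ℂ (Set.range (delMonomial k)) := by
    rw [span_range_delMonomial]; trivial
  induction hr using Submodule.span_induction with
  | mem r hr =>
    obtain ⟨u, rfl⟩ := hr
    rw [toLaurent_delMonomial, AddMonoidAlgebra.coeff_single,
      Finsupp.single_eq_of_ne (hα u).symm]
  | zero => rw [map_zero, AddMonoidAlgebra.coeff_zero, Finsupp.zero_apply]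
  | add r s _ _ hr hs =>
    rw [map_add, AddMonoidAlgebra.coeff_add, Finsupp.add_apply, hr, hs, add_zero]
  | smul c r _ hr =>
    rw [map_smul, AddMonoidAlgebra.coeff_smul, Finsupp.smul_apply, hr, smul_zero]

theorem isUnit_toLaurent_del (b : Fin (m + 2)) : IsUnit (toLaurent k (del k b)) := by
  rw [← pow_one (del k b), ← delMonomial_single, toLaurent_delMonomial]
  exact (Group.isUnit (Multiplicative.ofAdd _)).map (AddMonoidAlgebra.of ℂ (Fin 2 → ℤ))

theorem mulVec_natCast_add {ι σ : Type*} [Fintype σ] (A : Matrix ι σ ℤ) (u w : σ → ℕ) :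
    A.mulVec (fun j => ((u + w) j : ℤ)) =
      A.mulVec (fun j => (u j : ℤ)) + A.mulVec fun j => (w j : ℤ) := by
  rw [← Matrix.mulVec_add]
  exact congrArg _ (funext fun j => Nat.cast_add _ _)

theorem mulVec_toNat {ι σ : Type*} [Fintype σ] [DecidableEq σ] (A : Matrix ι σ ℤ) {b : σ}
    {v : σ → ℤ} (hv : ∀ i, i ≠ b → 0 ≤ v i) :
    A.mulVec (fun j => ((v j).toNat : ℤ)) =
      A.mulVec v + A.mulVec fun j => ((Pi.single b (-v b).toNat : σ → ℕ) j : ℤ) := by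
  rw [← Matrix.mulVec_add]
  refine congrArg _ (funext fun i => ?_)
  rcases eq_or_ne i b with rfl | hi
  · simp only [Pi.add_apply, Pi.single_eq_same]
    omega
  · simp [hi, hv i hi]

theorem laurentMonomial_mul_delMonomial (hv : ∀ i, i ≠ b → 0 ≤ v i) {u w : Fin (m + 2) → ℕ}
    (h : (curveMatrix k).mulVec (fun j => (w j : ℤ)) =
      (curveMatrix k).mulVec v + (curveMatrix k).mulVec fun j => (u j : ℤ)) :
    laurentMonomial k b v * algebraMap _ _ (delMonomial k u) =
      algebraMap _ _ (delMonomial k w) := by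
  have hclear : laurentMonomial k b v * algebraMap _ _ (del k b ^ (-v b).toNat) =
      algebraMap _ _ (delMonomial k fun i => (v i).toNat) := by
    rw [laurentMonomial, map_pow, mul_assoc, ← mul_pow, mul_comm (IsLocalization.Away.invSelf _),
      IsLocalization.Away.mul_invSelf, one_pow, mul_one, delMonomial]
  have hunit : IsUnit (algebraMap (ToricRing k) (AwayDel k b) (del k b ^ (-v b).toNat)) := by
    rw [map_pow]
    exact (IsLocalization.Away.algebraMap_isUnit (del k b)).pow _
  refine hunit.mul_right_cancel ?_
  rw [mul_right_comm, hclear, ← map_mul, ← map_mul, ← delMonomial_single, ← delMonomial_add,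
    ← delMonomial_add]
  congr 1
  apply delMonomial_eq_of_mulVec_eq
  rw [mulVec_natCast_add, mulVec_natCast_add, mulVec_toNat _ hv, h]
  abel

theorem isUnit_algebraMap_delMonomial_single {T : Type*} [CommRing T] [Algebra (ToricRing k) T]
    (hb : IsUnit (algebraMap (ToricRing k) T (del k b))) (r : ℕ) :
    IsUnit (algebraMap (ToricRing k) T (delMonomial k (Pi.single b r))) := by
  rw [delMonomial_single, map_pow]
  exact hb.pow r

theorem map_laurentMonomial_eq {T : Type*} [CommRing T] [Algebra (ToricRing k) T]
    (g : AwayDel k b →ₐ[ToricRing k] T) (g' : AwayDel k b' →ₐ[ToricRing k] T)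
    (hb : IsUnit (algebraMap (ToricRing k) T (del k b)))
    (hb' : IsUnit (algebraMap (ToricRing k) T (del k b')))
    (hv : ∀ i, i ≠ b → 0 ≤ v i) (hv' : ∀ i, i ≠ b' → 0 ≤ v' i)
    (h : (curveMatrix k).mulVec v = (curveMatrix k).mulVec v') :
    g (laurentMonomial k b v) = g' (laurentMonomial k b' v') := by
  set u : Fin (m + 2) → ℕ := Pi.single b (-v b).toNat
  set u' : Fin (m + 2) → ℕ := Pi.single b' (-v' b').toNat
  set w : Fin (m + 2) → ℕ := (fun i => (v i).toNat) + u'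
  have hdeg : (curveMatrix k).mulVec (fun j => (w j : ℤ)) =
      (curveMatrix k).mulVec v + (curveMatrix k).mulVec fun j => ((u + u') j : ℤ) := by
    rw [mulVec_natCast_add, mulVec_natCast_add, mulVec_toNat _ hv, add_assoc]
  have hunit : IsUnit (algebraMap (ToricRing k) T (delMonomial k (u + u'))) := by
    rw [delMonomial_add, map_mul]
    exact (isUnit_algebraMap_delMonomial_single hb _).mul
      (isUnit_algebraMap_delMonomial_single hb' _)
  have hfirst := congrArg g (laurentMonomial_mul_delMonomial hv hdeg)
  have hsecond := congrArg g' (laurentMonomial_mul_delMonomial hv' (h ▸ hdeg))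
  rw [map_mul, AlgHom.commutes, AlgHom.commutes] at hfirst hsecond
  exact hunit.mul_right_cancel (hfirst.trans hsecond.symm)

theorem awayGraded_mulVec_eq_span (hv : ∀ i, i ≠ b → 0 ≤ v i) :
    awayGraded k b ((curveMatrix k).mulVec v) = Submodule.span ℂ {laurentMonomial k b v} := by
  refine congrArg _ (Set.ext fun y => ⟨?_, ?_⟩)
  · rintro ⟨w, hw, hwv, rfl⟩
    have hunit := IsLocalization.Away.algebraMap_isUnit (S := AwayDel k b) (del k b)
    exact map_laurentMonomial_eq (AlgHom.id _ _) (AlgHom.id _ _) hunit hunit hw hv hwv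
  · rintro rfl
    exact ⟨v, hv, rfl, rfl⟩

theorem map_laurentMonomial_of_comp_algebraMap {ψ : AwayDel k b →+* AddMonoidAlgebra ℂ (Fin 2 → ℤ)}
    (hψ : ∀ r, ψ (algebraMap _ _ r) = toLaurent k r) (hv : ∀ i, i ≠ b → 0 ≤ v i) :
    ψ (laurentMonomial k b v) = AddMonoidAlgebra.single ((curveMatrix k).mulVec v) 1 := by
  have hclear := congrArg ψ (laurentMonomial_mul_delMonomial hv (mulVec_toNat _ hv))
  rw [map_mul, hψ, hψ, toLaurent_delMonomial, toLaurent_delMonomial, mulVec_toNat _ hv] at hclear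
  refine ((isUnit_toLaurent_del (k := k) b).pow (-v b).toNat).mul_right_cancel ?_
  rw [← map_pow, ← delMonomial_single, toLaurent_delMonomial, hclear,
    AddMonoidAlgebra.single_mul_single, mul_one]

theorem awayFirst_laurentMonomial_ne_zero (hv : ∀ i, i ≠ 0 → 0 ≤ v i) :
    awayFirst k (laurentMonomial k 0 v) ≠ 0 := by
  have hunit : IsUnit (toLaurent k (del k 0 * del k (Fin.last (m + 1)))) := by
    rw [map_mul]
    exact (isUnit_toLaurent_del _).mul (isUnit_toLaurent_del _)
  let ψ : AwayBoth k →+* AddMonoidAlgebra ℂ (Fin 2 → ℤ) :=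
    IsLocalization.Away.lift (g := (toLaurent k).toRingHom) _ hunit
  have hψ (r : ToricRing k) : ψ (awayFirst k (algebraMap _ _ r)) = toLaurent k r := by
    rw [AlgHom.commutes]
    exact IsLocalization.Away.lift_eq _ hunit r
  refine ne_zero_of_map (f := ψ) ?_
  rw [show ψ (awayFirst k _) = _ from
    map_laurentMonomial_of_comp_algebraMap (ψ := ψ.comp (awayFirst k).toRingHom) hψ hv]
  exact AddMonoidAlgebra.single_ne_zero.2 one_ne_zero

theorem algebraMap_ne_laurentMonomial (hv : ∀ i, i ≠ b → 0 ≤ v i)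
    (hmem : ∀ u : Fin (m + 2) → ℕ,
      (curveMatrix k).mulVec (fun j => (u j : ℤ)) ≠ (curveMatrix k).mulVec v)
    (r : ToricRing k) : algebraMap _ (AwayDel k b) r ≠ laurentMonomial k b v := by
  intro hr
  have hψ := IsLocalization.Away.lift_eq (S := AwayDel k b) (g := (toLaurent k).toRingHom) (del k b)
    (isUnit_toLaurent_del b)
  have hsingle := (hψ r).symm.trans
    ((congrArg _ hr).trans (map_laurentMonomial_of_comp_algebraMap hψ hv))
  have hcoeff := coeff_toLaurent_eq_zero hmem r
  rw [show toLaurent k r = _ from hsingle, AddMonoidAlgebra.coeff_single,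
    Finsupp.single_eq_same] at hcoeff
  exact one_ne_zero hcoeff

theorem awayFirst_laurentMonomial_eq_awayLast (hv : ∀ i, i ≠ 0 → 0 ≤ v i)
    (hv' : ∀ i, i ≠ Fin.last (m + 1) → 0 ≤ v' i)
    (h : (curveMatrix k).mulVec v = (curveMatrix k).mulVec v') :
    awayFirst k (laurentMonomial k 0 v) =
      awayLast k (laurentMonomial k (Fin.last (m + 1)) v') := by
  have hunit := IsLocalization.Away.algebraMap_isUnit (S := AwayBoth k)
    (del k 0 * del k (Fin.last (m + 1)))
  rw [map_mul, IsUnit.mul_iff] at hunit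
  exact map_laurentMonomial_eq _ _ hunit.1 hunit.2 hv hv' h

theorem laurentMonomial_mem_ker_ishidaD1 (hv : ∀ i, i ≠ 0 → 0 ≤ v i)
    (hv' : ∀ i, i ≠ Fin.last (m + 1) → 0 ≤ v' i)
    (h : (curveMatrix k).mulVec v = (curveMatrix k).mulVec v') :
    (laurentMonomial k 0 v, laurentMonomial k (Fin.last (m + 1)) v') ∈
      LinearMap.ker (ishidaD1 k) :=
  LinearMap.mem_ker.2 (sub_eq_zero.2 (awayFirst_laurentMonomial_eq_awayLast hv hv' h).symm)

theorem ishidaClass_laurentMonomial_ne_zero (hv : ∀ i, i ≠ 0 → 0 ≤ v i)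
    (hmem : ∀ u : Fin (m + 2) → ℕ,
      (curveMatrix k).mulVec (fun j => (u j : ℤ)) ≠ (curveMatrix k).mulVec v)
    {y : AwayDel k (Fin.last (m + 1))}
    (hker : (laurentMonomial k 0 v, y) ∈ LinearMap.ker (ishidaD1 k)) :
    ishidaClass k ⟨_, hker⟩ ≠ 0 := by
  intro hzero
  obtain ⟨r, hr⟩ := (Submodule.Quotient.mk_eq_zero _).1 hzero
  exact algebraMap_ne_laurentMonomial hv hmem r (congrArg Prod.fst hr)

theorem ishidaH1Graded_mulVec_eq_span (hv : ∀ i, i ≠ 0 → 0 ≤ v i)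
    (hv' : ∀ i, i ≠ Fin.last (m + 1) → 0 ≤ v' i)
    (h : (curveMatrix k).mulVec v = (curveMatrix k).mulVec v') :
    ishidaH1Graded k ((curveMatrix k).mulVec v) =
      Submodule.span ℂ {ishidaClass k ⟨_, laurentMonomial_mem_ker_ishidaD1 hv hv' h⟩} := by
  have hfirst := awayGraded_mulVec_eq_span (k := k) hv
  have hlast := awayGraded_mulVec_eq_span (k := k) hv'
  rw [← h] at hlast
  apply le_antisymm
  · rintro _ ⟨⟨⟨x, y⟩, hxy⟩, ⟨hx, hy⟩, rfl⟩
    obtain ⟨c, rfl⟩ := Submodule.mem_span_singleton.1 (hfirst.le hx)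
    obtain ⟨c', rfl⟩ := Submodule.mem_span_singleton.1 (hlast.le hy)
    have hsmul : c' • awayFirst k (laurentMonomial k 0 v) =
        c • awayFirst k (laurentMonomial k 0 v) := by
      conv_lhs => rw [awayFirst_laurentMonomial_eq_awayLast hv hv' h]
      exact ((awayLast k).toLinearMap.map_smul_of_tower c' _).symm.trans
        ((sub_eq_zero.1 hxy).trans ((awayFirst k).toLinearMap.map_smul_of_tower c _))
    obtain rfl := smul_left_injective ℂ (awayFirst_laurentMonomial_ne_zero hv) hsmul
    exact Submodule.mem_span_singleton.2 ⟨c', ((ishidaClass k).map_smul c' _).symm⟩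
  · rw [Submodule.span_singleton_le_iff_mem]
    exact ⟨_, ⟨hfirst.ge (Submodule.mem_span_singleton_self _),
      hlast.ge (Submodule.mem_span_singleton_self _)⟩, rfl⟩

end Cohomology

section PolarSeries

variable {m : ℕ} {k d : Fin (m + 2) → ℕ} {b : Fin (m + 2)} {N : ℕ} {l : ℂ} {c c' : Composition N}
  {w : Fin (m + 2) → ℂ} {α : Fin 2 → ℤ}

theorem mem_orderedPartitions :
    c ∈ orderedPartitions d b N ↔ ∀ a ∈ c.blocks, ∃ i, i ≠ b ∧ d i = a := by
  simp [orderedPartitions]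

theorem sum_mul_count {ι : Type*} {s : Finset ι} {d : ι → ℕ}
    (hd : Set.InjOn d s) (g : ℕ → ℕ) {L : List ℕ} (hL : ∀ a ∈ L, ∃ i ∈ s, d i = a) :
    ∑ i ∈ s, g (d i) * L.count (d i) = (L.map g).sum := by
  rw [Finset.sum_list_map_count, ← Finset.sum_image (f := fun a => g a * L.count a) hd]
  simp only [smul_eq_mul, mul_comm (List.count _ _)]
  refine (Finset.sum_subset (fun a ha => ?_) fun a _ ha => ?_).symm
  · simpa using hL a (List.mem_toFinset.1 ha)
  · rw [List.count_eq_zero_of_not_mem (mt List.mem_toFinset.2 ha), mul_zero]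

theorem sum_mul_partMultiplicity (hd : Function.Injective d)
    (hc : c ∈ orderedPartitions d b N) (g : ℕ → ℕ) :
    ∑ i ∈ Finset.univ.erase b, g (d i) * partMultiplicity d c i = (c.blocks.map g).sum :=
  sum_mul_count hd.injOn g (by simpa using mem_orderedPartitions.1 hc)

/-- The exponent vector of the monomial belonging to `c` when the parameter `l = t` is an
integer. -/
def intExponent (d : Fin (m + 2) → ℕ) (b : Fin (m + 2)) (t : ℤ) (c : Composition N) :
    Fin (m + 2) → ℤ :=
  fun i => if i = b then t - c.length else partMultiplicity d c i

theorem polarExponent_intCast (t : ℤ) (c : Composition N) (i : Fin (m + 2)) :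
    polarExponent d b (t : ℂ) c i = (intExponent d b t c i : ℂ) := by
  unfold polarExponent intExponent
  split_ifs <;> simp

theorem intExponent_self (t : ℤ) (c : Composition N) : intExponent d b t c b = t - c.length :=
  if_pos rfl

theorem intExponent_of_ne (t : ℤ) (c : Composition N) {i : Fin (m + 2)} (hi : i ≠ b) :
    intExponent d b t c i = partMultiplicity d c i :=
  if_neg hi

theorem sum_intExponent (hd : Function.Injective d) (t : ℤ) (hc : c ∈ orderedPartitions d b N) :
    ∑ i, intExponent d b t c i = t := by
  have hcount : ∑ i ∈ Finset.univ.erase b, (partMultiplicity d c i : ℤ) = c.length := by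
    exact_mod_cast by simpa using sum_mul_partMultiplicity hd hc fun _ => 1
  rw [← Finset.add_sum_erase _ _ (Finset.mem_univ b), intExponent_self,
    Finset.sum_congr rfl fun i hi => intExponent_of_ne t c (Finset.ne_of_mem_erase hi), hcount,
    sub_add_cancel]

theorem sum_mul_intExponent (hd : Function.Injective d) (hb : d b = 0) (t : ℤ)
    (hc : c ∈ orderedPartitions d b N) : ∑ i, (d i : ℤ) * intExponent d b t c i = N := by
  have hcount : ∑ i ∈ Finset.univ.erase b, (d i : ℤ) * partMultiplicity d c i = N := by
    exact_mod_cast by simpa using sum_mul_partMultiplicity hd hc id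
  rw [← Finset.add_sum_erase _ _ (Finset.mem_univ b), hb, Nat.cast_zero, zero_mul, zero_add,
    ← hcount]
  exact Finset.sum_congr rfl fun i hi => by rw [intExponent_of_ne t c (Finset.ne_of_mem_erase hi)]

theorem orderedPartitions_nonempty (hd : Function.Injective d) (hb : d b = 0)
    {v : Fin (m + 2) → ℤ} (hv : ∀ i, i ≠ b → 0 ≤ v i) (hN : ∑ i, (d i : ℤ) * v i = N) :
    (orderedPartitions d b N).Nonempty := by
  let M : Multiset ℕ := ∑ i ∈ Finset.univ.erase b, Multiset.replicate (v i).toNat (d i)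
  have hmem {a : ℕ} (ha : a ∈ M.toList) : ∃ i, i ≠ b ∧ d i = a := by
    obtain ⟨i, hi, hai⟩ := Multiset.mem_sum.1 (Multiset.mem_toList.1 ha)
    exact ⟨i, Finset.ne_of_mem_erase hi, (Multiset.eq_of_mem_replicate hai).symm⟩
  have hsum : M.toList.sum = N := by
    rw [Multiset.sum_toList, Multiset.sum_sum]
    zify
    rw [← hN, ← Finset.add_sum_erase _ _ (Finset.mem_univ b), hb, Nat.cast_zero, zero_mul,
      zero_add]
    refine Finset.sum_congr rfl fun i hi => ?_
    rw [Multiset.map_replicate, Multiset.sum_replicate, nsmul_eq_mul,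
      Int.toNat_of_nonneg (hv i (Finset.ne_of_mem_erase hi)), mul_comm]
  have hpos {a : ℕ} (ha : a ∈ M.toList) : 0 < a := by
    obtain ⟨i, hi, rfl⟩ := hmem ha
    exact Nat.pos_of_ne_zero (hb ▸ hd.ne hi)
  exact ⟨⟨M.toList, hpos, hsum⟩, mem_orderedPartitions.2 fun a ha => hmem ha⟩

theorem exists_length_eq_minLength (h : (orderedPartitions d b N).Nonempty) :
    ∃ c ∈ orderedPartitions d b N, c.length = minLength d b N :=
  Nat.sInf_mem (Set.Nonempty.image _ h)

/-- The factor of `polarCoeff` that depends only on the exponent vector of the monomial. -/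
def exponentFactor (d : Fin (m + 2) → ℕ) (b : Fin (m + 2)) (l : ℂ) (c : Composition N) : ℂ :=
  (∏ i ∈ Finset.Ico (minLength d b N) c.length, (l - i)) *
    ∏ i ∈ Finset.univ.erase b, (d i : ℂ) ^ partMultiplicity d c i

theorem polarCoeff_eq_exponentFactor_mul :
    polarCoeff d b l c = exponentFactor d b l c *
      ((∏ i ∈ Finset.Ico 1 c.length, ((N : ℝ) - c.sizeUpTo i)⁻¹ : ℝ) : ℂ) := by
  rw [polarCoeff, exponentFactor, mul_right_comm]
  push_cast
  rfl

theorem exponentFactor_eq_of_polarExponent_eq (h : polarExponent d b l c = polarExponent d b l c') :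
    exponentFactor d b l c = exponentFactor d b l c' := by
  have hlength : c.length = c'.length := by
    simpa [polarExponent] using congrFun h b
  have hmultiplicity : ∀ i ∈ Finset.univ.erase b,
      partMultiplicity d c i = partMultiplicity d c' i := fun i hi => by
    simpa [polarExponent, Finset.ne_of_mem_erase hi] using congrFun h i
  rw [exponentFactor, exponentFactor, hlength]
  exact congrArg _ (Finset.prod_congr rfl fun i hi => by rw [hmultiplicity i hi])

theorem exponentFactor_ne_zero (hd : Function.Injective d) (hb : d b = 0)
    (hl : ∀ i : ℕ, minLength d b N ≤ i → l ≠ i) (c : Composition N) :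
    exponentFactor d b l c ≠ 0 := by
  refine mul_ne_zero (Finset.prod_ne_zero_iff.2 fun i hi => ?_)
    (Finset.prod_ne_zero_iff.2 fun i hi => pow_ne_zero _ ?_)
  · exact sub_ne_zero.2 (hl i (Finset.mem_Ico.1 hi).1)
  · exact Nat.cast_ne_zero.2 (hb ▸ hd.ne (Finset.ne_of_mem_erase hi))

theorem prod_inv_sub_sizeUpTo_pos (c : Composition N) :
    0 < ∏ i ∈ Finset.Ico 1 c.length, ((N : ℝ) - c.sizeUpTo i)⁻¹ := by
  refine Finset.prod_pos fun i hi => inv_pos.2 (sub_pos.2 (Nat.cast_lt.2 ?_))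
  exact (c.sizeUpTo_strict_mono (Finset.mem_Ico.1 hi).2).trans_le (c.sizeUpTo_le _)

-- Terms with equal exponents have coefficients that are positive multiples of one another, so
-- they do not cancel.
theorem polarExponent_mem_support_polarSeries (hd : Function.Injective d) (hb : d b = 0)
    (hl : ∀ i : ℕ, minLength d b N ≤ i → l ≠ i) (hc : c ∈ orderedPartitions d b N) :
    polarExponent d b l c ∈ (polarSeries d b N l).support := by
  classical
  rw [Finsupp.mem_support_iff, polarSeries, Finsupp.finsetSum_apply]
  simp only [Finsupp.single_apply]
  rw [← Finset.sum_filter, Finset.sum_congr rfl fun c' hc' => by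
    rw [polarCoeff_eq_exponentFactor_mul,
      exponentFactor_eq_of_polarExponent_eq (Finset.mem_filter.1 hc').2],
    ← Finset.mul_sum, ← Complex.ofReal_sum]
  refine mul_ne_zero (exponentFactor_ne_zero hd hb hl c) (Complex.ofReal_ne_zero.2 ?_)
  refine (Finset.sum_pos (fun c' _ => prod_inv_sub_sizeUpTo_pos c') ⟨c, ?_⟩).ne'
  exact Finset.mem_filter.2 ⟨hc, rfl⟩

theorem exists_of_mem_support_polarSeries (hw : w ∈ (polarSeries d b N l).support) :
    ∃ c ∈ orderedPartitions d b N, w = polarExponent d b l c := by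
  classical
  obtain ⟨c, hc, h⟩ := Finset.mem_biUnion.1 (Finsupp.support_finsetSum hw)
  exact ⟨c, hc, Finset.mem_singleton.1 (Finsupp.support_single_subset h)⟩

theorem exists_int_of_mem_support_polarSeries (hd : Function.Injective d) (hb : d b = 0) {t : ℤ}
    (hw : w ∈ (polarSeries d b N (t : ℂ)).support) :
    ∃ v : Fin (m + 2) → ℤ, (∀ i, w i = (v i : ℂ)) ∧ (∀ i, i ≠ b → 0 ≤ v i) ∧
      ∑ i, v i = t ∧ ∑ i, (d i : ℤ) * v i = N := by
  obtain ⟨c, hc, rfl⟩ := exists_of_mem_support_polarSeries hw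
  exact ⟨intExponent d b t c, polarExponent_intCast t c,
    fun i hi => intExponent_of_ne t c hi ▸ Int.natCast_nonneg _, sum_intExponent hd t hc,
    sum_mul_intExponent hd hb t hc⟩

theorem exists_nat_of_minLength_le (hd : Function.Injective d) (hb : d b = 0)
    (hne : (orderedPartitions d b N).Nonempty) {t : ℕ} (ht : minLength d b N ≤ t) :
    ∃ u : Fin (m + 2) → ℕ, ∑ i, (u i : ℤ) = t ∧ ∑ i, (d i : ℤ) * u i = N := by
  obtain ⟨c, hc, hlength⟩ := exists_length_eq_minLength hne
  have hnonneg : ∀ i, 0 ≤ intExponent d b t c i := fun i => by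
    rcases eq_or_ne i b with rfl | hi
    · rw [intExponent_self]
      omega
    · exact intExponent_of_ne t c hi ▸ Int.natCast_nonneg _
  have hsum := sum_intExponent hd t hc
  have hweight := sum_mul_intExponent hd hb t hc
  lift intExponent d b t c to Fin (m + 2) → ℕ using hnonneg with u
  exact ⟨u, hsum, hweight⟩

theorem polarSeries_support_nonempty (hd : Function.Injective d) (hb : d b = 0) {t : ℤ}
    {v : Fin (m + 2) → ℤ} (hv : ∀ i, i ≠ b → 0 ≤ v i) (hN : ∑ i, (d i : ℤ) * v i = N)
    (hgap : ∀ u : Fin (m + 2) → ℕ, ∑ i, (u i : ℤ) = t → ∑ i, (d i : ℤ) * u i ≠ N) :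
    (polarSeries d b N (t : ℂ)).support.Nonempty := by
  have hne := orderedPartitions_nonempty hd hb hv hN
  refine ⟨_, polarExponent_mem_support_polarSeries hd hb (fun i hi hti => ?_) hne.choose_spec⟩
  obtain ⟨u, hsum, hweight⟩ := exists_nat_of_minLength_le hd hb hne hi
  exact hgap u (hsum.trans (by exact_mod_cast hti.symm)) hweight

theorem IsGap.polarSolutionFirst_support_nonempty (hα : IsGap k α) (hk : StrictMono k)
    (hk0 : k 0 = 0) (hN : α 1 = N) : (polarSolutionFirst k N (α 0)).support.Nonempty := by
  obtain ⟨v, hv, hvα⟩ := hα.first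
  refine polarSeries_support_nonempty hk.injective hk0 hv
    (hN ▸ (mulVec_curveMatrix_eq_iff.1 hvα).2) fun u hsum hweight => hα.not_mem u ?_
  exact mulVec_curveMatrix_eq_iff.2 ⟨hsum, hweight.trans hN.symm⟩

theorem IsGap.polarSolutionLast_support_nonempty (hα : IsGap k α) (hk : StrictMono k)
    (hN : k (Fin.last (m + 1)) * α 0 - α 1 = N) :
    (polarSolutionLast k N (α 0)).support.Nonempty := by
  obtain ⟨v, hv, hvα⟩ := hα.last
  refine polarSeries_support_nonempty (coexponents_injective hk) coexponents_last hv
    (hN ▸ ((mulVec_curveMatrix_eq_iff_coexponents hk).1 hvα).2)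
    fun u hsum hweight => hα.not_mem u ?_
  exact (mulVec_curveMatrix_eq_iff_coexponents hk).2 ⟨hsum, hweight.trans hN.symm⟩

theorem exists_int_of_mem_support_polarSolutionFirst (hk : StrictMono k) (hk0 : k 0 = 0)
    (hN : α 1 = N) (hw : w ∈ (polarSolutionFirst k N (α 0)).support) :
    ∃ v : Fin (m + 2) → ℤ, (∀ i, w i = (v i : ℂ)) ∧ (∀ i, i ≠ 0 → 0 ≤ v i) ∧
      (curveMatrix k).mulVec v = α := by
  obtain ⟨v, hwv, hv, hsum, hweight⟩ :=
    exists_int_of_mem_support_polarSeries hk.injective hk0 hw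
  exact ⟨v, hwv, hv, mulVec_curveMatrix_eq_iff.2 ⟨hsum, hweight.trans hN.symm⟩⟩

theorem exists_int_of_mem_support_polarSolutionLast (hk : StrictMono k)
    (hN : k (Fin.last (m + 1)) * α 0 - α 1 = N)
    (hw : w ∈ (polarSolutionLast k N (α 0)).support) :
    ∃ v : Fin (m + 2) → ℤ, (∀ i, w i = (v i : ℂ)) ∧
      (∀ i, i ≠ Fin.last (m + 1) → 0 ≤ v i) ∧ (curveMatrix k).mulVec v = α := by
  obtain ⟨v, hwv, hv, hsum, hweight⟩ :=
    exists_int_of_mem_support_polarSeries (coexponents_injective hk) coexponents_last hw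
  exact ⟨v, hwv, hv,
    (mulVec_curveMatrix_eq_iff_coexponents hk).2 ⟨hsum, hweight.trans hN.symm⟩⟩

end PolarSeries

end MonomialCurve

end

open MonomialCurve in
theorem mainTheorem10_general {m : ℕ} (k : Fin (m + 2) → ℕ) (hk : StrictMono k) (hk0 : k 0 = 0)
    (β : Fin 2 → ℂ) (hβ : ((k (Fin.last (m + 1)) / Finset.univ.gcd k : ℕ) : Cardinal) <
      Module.rank ℂ (solutionGerms (curveMatrix k) β (basePoint m))) :
    ∃ (α : Fin 2 → ℤ) (N N' : ℕ),
      (∀ i, β i = (α i : ℂ)) ∧ β 1 = (N : ℂ) ∧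
      (k (Fin.last (m + 1)) : ℂ) * β 0 - β 1 = (N' : ℂ) ∧
      (polarSolutionFirst k N (β 0)).support.Nonempty ∧
      (polarSolutionLast k N' (β 0)).support.Nonempty ∧
      ∀ w ∈ (polarSolutionFirst k N (β 0)).support,
      ∀ w' ∈ (polarSolutionLast k N' (β 0)).support,
        ∃ v v' : Fin (m + 2) → ℤ,
          (∀ i, w i = (v i : ℂ)) ∧ (∀ i, w' i = (v' i : ℂ)) ∧
          (∀ i, i ≠ 0 → 0 ≤ v i) ∧ (∀ i, i ≠ Fin.last (m + 1) → 0 ≤ v' i) ∧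
          ∃ h : (laurentMonomial k 0 v, laurentMonomial k (Fin.last (m + 1)) v') ∈
              LinearMap.ker (ishidaD1 k),
            ishidaClass k ⟨_, h⟩ ≠ 0 ∧
            ishidaH1Graded k α = Submodule.span ℂ {ishidaClass k ⟨_, h⟩} := by
  obtain ⟨α, hα, hβα⟩ := exists_isGap_of_lt_rank hk hk0 hβ
  obtain rfl : β = fun i => (α i : ℂ) := funext hβα
  obtain ⟨N, hN⟩ := hα.exists_eq_natCast hk0
  obtain ⟨N', hN'⟩ := hα.exists_sub_eq_natCast hk
  refine ⟨α, N, N', fun _ => rfl, by simpa using congrArg (Int.cast (R := ℂ)) hN,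
    by simpa using congrArg (Int.cast (R := ℂ)) hN',
    hα.polarSolutionFirst_support_nonempty hk hk0 hN, hα.polarSolutionLast_support_nonempty hk hN',
    fun w hw w' hw' => ?_⟩
  obtain ⟨v, hwv, hv, hvα⟩ := exists_int_of_mem_support_polarSolutionFirst hk hk0 hN hw
  obtain ⟨v', hwv', hv', hvα'⟩ := exists_int_of_mem_support_polarSolutionLast hk hN' hw'
  have hdegree := hvα.trans hvα'.symm
  subst hvα
  exact ⟨v, v', hwv, hwv', hv, hv', laurentMonomial_mem_ker_ishidaD1 hv hv' hdegree,
    ishidaClass_laurentMonomial_ne_zero hv hα.not_mem _,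
    ishidaH1Graded_mulVec_eq_span hv hv' hdegree⟩

open MonomialCurve in
theorem mainTheorem10 {m : ℕ} (k : Fin (m + 2) → ℕ) (hk : StrictMono k) (hk0 : k 0 = 0)
    (hgcd : Finset.univ.gcd k = 1) (β : Fin 2 → ℂ) (hβ : β ∈ rankJumping k) :
    ∃ (α : Fin 2 → ℤ) (N N' : ℕ),
      (∀ i, β i = (α i : ℂ)) ∧ β 1 = (N : ℂ) ∧
      (k (Fin.last (m + 1)) : ℂ) * β 0 - β 1 = (N' : ℂ) ∧
      (polarSolutionFirst k N (β 0)).support.Nonempty ∧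
      (polarSolutionLast k N' (β 0)).support.Nonempty ∧
      ∀ w ∈ (polarSolutionFirst k N (β 0)).support,
      ∀ w' ∈ (polarSolutionLast k N' (β 0)).support,
        ∃ v v' : Fin (m + 2) → ℤ,
          (∀ i, w i = (v i : ℂ)) ∧ (∀ i, w' i = (v' i : ℂ)) ∧
          (∀ i, i ≠ 0 → 0 ≤ v i) ∧ (∀ i, i ≠ Fin.last (m + 1) → 0 ≤ v' i) ∧
          ∃ h : (laurentMonomial k 0 v, laurentMonomial k (Fin.last (m + 1)) v') ∈
              LinearMap.ker (ishidaD1 k),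
            ishidaClass k ⟨_, h⟩ ≠ 0 ∧
            ishidaH1Graded k α = Submodule.span ℂ {ishidaClass k ⟨_, h⟩} :=
  mainTheorem10_general k hk hk0 β
    (by simpa [hgcd] using hβ _ (basePoint_mem_nonsingularLocus hk hk0))
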